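/- Let $F$ be a field and let $D$ be a subring of $F$. A valuation ring of $F$ is a subring $V$ of $F$ such that $x\in V$ or $x^{-1}\in V$ for each nonzero $x\in F$. Let $\mathfrak X$ be the Zariski-Riemann space of $F/D$, that is, the set of all valuation rings of $F$ that contain $D$, with the topology whose basic open sets are the sets $\{V\in\mathfrak X : t_1,\ldots,t_n\in V\}$ with $t_1,\ldots,t_n\in F$. Let $Z$ be a subspace of $\mathfrak X$ with $F\in Z$, and let $A=\bigcap_{V\in Z}V$. Regard $Z$ as a locally ringed space with structure sheaf $\mathcal O_Z(U)=\bigcap_{V\in U}V$ for nonempty open $U\subseteq Z$ and $\mathcal O_Z(\emptyset)=0$, restriction maps between nonempty open sets being inclusions. Let $Z\to\operatorname{Spec}(A)$ be the morphism of locally ringed spaces that corresponds to the identification $A=\mathcal O_Z(Z)$; it sends $V\in Z$ to the center of $V$ in $A$, i.e. the prime ideal of all elements of $A$ that are not units of $V$. Let $\mathbb P^1_A=\operatorname{Proj}(A[T_0,T_1])$, and for a homogeneous polynomial $f\in A[T_0,T_1]$ let $(\mathbb P^1_A)_f$ be the open subscheme of all points of $\mathbb P^1_A$ at which $f$ does not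 vanish. An $A$-morphism $\phi:Z\to\mathbb P^1_A$ is a morphism of locally ringed spaces whose composition with the structure morphism $\mathbb P^1_A\to\operatorname{Spec}(A)$ is the morphism $Z\to\operatorname{Spec}(A)$ above. A Prüfer domain is an integral domain all of whose localizations at prime ideals are valuation rings of its quotient field. Theorem. The following are equivalent. 1. $A$ is a Prüfer domain, the Picard group of $A$ is a torsion group, and $F$ is the quotient field of $A$. 2. For each $A$-morphism $\phi:Z\to\mathbb P^1_A$ there is a homogeneous polynomial $f\in A[T_0,T_1]$ of positive degree such that the image of $\phi$ is contained in $(\mathbb P^1_A)_f$. -/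

import Mathlib

open CategoryTheory TopologicalSpace Opposite AlgebraicGeometry

universe u

noncomputable section

/-- The Zariski-Riemann space of `F/D`: all valuation rings of the field `F` that contain the
subring `D`. -/
def ZariskiRiemann {F : Type u} [Field F] (D : Subring F) : Type u :=
  {V : ValuationSubring F // D ≤ V.toSubring}

namespace ZariskiRiemann

variable {F : Type u} [Field F] {D : Subring F}

/-- The valuation ring of `F` underlying a point of the Zariski-Riemann space. -/
def ring (V : ZariskiRiemann D) : ValuationSubring F := V.1

/-- The trivial valuation ring `F` itself, as a point of the Zariski-Riemann space. -/
def generic : ZariskiRiemann D := ⟨⊤, fun _ _ => ValuationSubring.mem_top _⟩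

/-- The topology whose basic open sets are `{V | t₁, …, tₙ ∈ V}` for `t₁, …, tₙ ∈ F`. -/
instance : TopologicalSpace (ZariskiRiemann D) :=
  TopologicalSpace.generateFrom
    {U | ∃ t : Finset F, U = {V : ZariskiRiemann D | ∀ x ∈ t, x ∈ V.ring}}

/-- The holomorphy ring `A = ⋂ V`, `V ∈ Z`, of a set `Z` of valuation rings of `F`. -/
def holomorphyRing (Z : Set (ZariskiRiemann D)) : Subring F :=
  ⨅ V ∈ Z, V.ring.toSubring

lemma mem_holomorphyRing {Z : Set (ZariskiRiemann D)} {a : F} :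
    a ∈ holomorphyRing Z ↔ ∀ V ∈ Z, a ∈ V.ring := by
  simp only [holomorphyRing, Subring.mem_iInf, ValuationSubring.mem_toSubring]

lemma isOpen_setOf_mem (t : F) : IsOpen {V : ZariskiRiemann D | t ∈ V.ring} :=
  TopologicalSpace.isOpen_generateFrom_of_mem ⟨{t}, by simp⟩

lemma generic_mem_of_isOpen {U : Set (ZariskiRiemann D)} (hU : IsOpen U) (hne : U.Nonempty) :
    generic ∈ U := by
  induction hU with
  | basic s hs =>
    obtain ⟨t, rfl⟩ := hs
    exact fun x _ => ValuationSubring.mem_top x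
  | univ => trivial
  | inter s t _ _ hs ht =>
    obtain ⟨x, hx, hx'⟩ := hne
    exact ⟨hs ⟨x, hx⟩, ht ⟨x, hx'⟩⟩
  | sUnion S _ ih =>
    obtain ⟨x, s, hs, hx⟩ := hne
    exact ⟨s, hs, ih s hs ⟨x, hx⟩⟩

variable (Z : Set (ZariskiRiemann D))

/-- The sections of the holomorphy sheaf over an open subset `U` of `Z`. A section is an element
of `⋂ V`, `V ∈ U`, recorded as the constant function on `U` with that value. In this way the ring
is the intersection `⋂ V`, `V ∈ U`, for nonempty `U` (see `holomorphySectionsEquiv`), and it is the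
trivial ring for empty `U`. -/
def holomorphySections (U : Opens (TopCat.of Z)) : Subring (U → F) where
  carrier := {s | (∀ V W : U, s V = s W) ∧ ∀ V : U, s V ∈ V.1.1.ring}
  zero_mem' := ⟨fun _ _ => rfl, fun V => V.1.1.ring.zero_mem⟩
  one_mem' := ⟨fun _ _ => rfl, fun V => V.1.1.ring.one_mem⟩
  add_mem' {a b} ha hb := ⟨fun V W => by simp only [Pi.add_apply, ha.1 V W, hb.1 V W],
    fun V => V.1.1.ring.add_mem _ _ (ha.2 V) (hb.2 V)⟩
  mul_mem' {a b} ha hb := ⟨fun V W => by simp only [Pi.mul_apply, ha.1 V W, hb.1 V W],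
    fun V => V.1.1.ring.mul_mem _ _ (ha.2 V) (hb.2 V)⟩
  neg_mem' {a} ha := ⟨fun V W => by simp only [Pi.neg_apply, ha.1 V W],
    fun V => V.1.1.ring.neg_mem _ (ha.2 V)⟩

/-- Over a nonempty open set `U`, the ring of sections is `⋂ V`, `V ∈ U`. -/
def holomorphySectionsEquiv (U : Opens (TopCat.of Z)) (V₀ : U) :
    holomorphySections Z U ≃+* (⨅ V : U, V.1.1.ring.toSubring : Subring F) where
  toFun s := ⟨s.1 V₀, Subring.mem_iInf.2 fun V => (s.2.1 V₀ V) ▸ s.2.2 V⟩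
  invFun a := ⟨fun _ => a.1, fun _ _ => rfl, fun V => Subring.mem_iInf.1 a.2 V⟩
  left_inv s := Subtype.ext (funext fun V => s.2.1 V₀ V)
  right_inv _ := rfl
  map_mul' _ _ := rfl
  map_add' _ _ := rfl

/-- The holomorphy presheaf on `Z`; restriction maps are restriction of constant functions, that
is, the set inclusions between the intersections. -/
def holomorphyPresheaf : TopCat.Presheaf CommRingCat.{u} (TopCat.of Z) where
  obj U := CommRingCat.of (holomorphySections Z U.unop)
  map {U V} i := CommRingCat.ofHom
    { toFun := fun s => ⟨fun W => s.1 ⟨W.1, leOfHom i.unop W.2⟩, fun _ _ => s.2.1 _ _,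
        fun W => s.2.2 ⟨W.1, leOfHom i.unop W.2⟩⟩
      map_zero' := rfl
      map_add' := fun _ _ => rfl
      map_one' := rfl
      map_mul' := fun _ _ => rfl }

variable {Z}

/-- The condition defining sections, as a local condition on `F`-valued functions; being constant
is a local condition because every nonempty open subset of `Z` contains the point `F`. -/
def holomorphyLocalPredicate (hF : generic ∈ Z) :
    TopCat.LocalPredicate fun _ : TopCat.of Z => F where
  pred {U} s := (∀ V W : U, s V = s W) ∧ ∀ V : U, s V ∈ V.1.1.ring
  res {U V} i f hf := ⟨fun _ _ => hf.1 _ _, fun W => hf.2 ⟨W.1, leOfHom i W.2⟩⟩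
  locality {U} f hf := by
    have key : ∀ (O : Opens (TopCat.of Z)) (x : TopCat.of Z), x ∈ O →
        (⟨generic, hF⟩ : TopCat.of Z) ∈ O := by
      intro O x hx
      obtain ⟨O', hO', h⟩ := isOpen_induced_iff.1 O.2
      have h1 : x.1 ∈ O' := by
        have : x ∈ Subtype.val ⁻¹' O' := by rw [h]; exact hx
        exact this
      have h2 : (⟨generic, hF⟩ : Z) ∈ (Subtype.val ⁻¹' O' : Set Z) :=
        generic_mem_of_isOpen hO' ⟨_, h1⟩
      rw [h] at h2
      exact h2
    refine ⟨fun V W => ?_, fun V => ?_⟩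
    · obtain ⟨O, hVO, i, h, -⟩ := hf V
      obtain ⟨O', hWO', i', h', -⟩ := hf W
      have e1 := h ⟨V.1, hVO⟩ ⟨_, key O _ hVO⟩
      have e2 := h' ⟨W.1, hWO'⟩ ⟨_, key O' _ hWO'⟩
      exact e1.trans e2.symm
    · obtain ⟨O, hVO, i, -, h⟩ := hf V
      exact h ⟨V.1, hVO⟩

lemma holomorphyPresheaf_isSheaf (hF : generic ∈ Z) : (holomorphyPresheaf Z).IsSheaf := by
  rw [TopCat.Presheaf.isSheaf_iff_isSheaf_comp (forget CommRingCat)]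
  refine TopCat.Presheaf.isSheaf_of_iso ?_
    (TopCat.subsheafToTypes (holomorphyLocalPredicate hF)).property
  exact NatIso.ofComponents (fun _ => Iso.refl _) (by intros; rfl)

variable (Z) in
/-- The value of a section over `U` at a point `V` of `U`, as an element of `V`. -/
def evalAt (U : Opens (TopCat.of Z)) (V : TopCat.of Z) (hV : V ∈ U) :
    (holomorphyPresheaf Z).obj (op U) ⟶ CommRingCat.of V.1.ring :=
  CommRingCat.ofHom
    { toFun := fun s => ⟨s.1 ⟨V, hV⟩, s.2.2 ⟨V, hV⟩⟩
      map_zero' := rfl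
      map_add' := fun _ _ => rfl
      map_one' := rfl
      map_mul' := fun _ _ => rfl }

variable (Z) in
/-- The ring homomorphism from the stalk of the holomorphy sheaf at `V` to `V`, given by taking the
value of a section. -/
def stalkToRing (V : TopCat.of Z) :
    (holomorphyPresheaf Z).stalk V ⟶ CommRingCat.of V.1.ring :=
  Limits.colimit.desc ((OpenNhds.inclusion V).op ⋙ holomorphyPresheaf Z)
    { pt := _
      ι := { app := fun U => evalAt Z ((OpenNhds.inclusion V).obj U.unop) V U.unop.2 } }

lemma germ_comp_stalkToRing (V : TopCat.of Z) (U : Opens (TopCat.of Z)) (hV : V ∈ U) :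
    (holomorphyPresheaf Z).germ U V hV ≫ stalkToRing Z V = evalAt Z U V hV :=
  Limits.colimit.ι_desc _ _

lemma stalkToRing_germ (V : TopCat.of Z) (U : Opens (TopCat.of Z)) (hV : V ∈ U)
    (s : (holomorphyPresheaf Z).obj (op U)) :
    (stalkToRing Z V).hom (((holomorphyPresheaf Z).germ U V hV).hom s) =
      ⟨s.1 ⟨V, hV⟩, s.2.2 ⟨V, hV⟩⟩ :=
  RingHom.ext_iff.1 (CommRingCat.hom_ext_iff.mp (germ_comp_stalkToRing V U hV)) s

instance isLocalHom_stalkToRing (V : TopCat.of Z) : IsLocalHom (stalkToRing Z V).hom := by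
  refine ⟨fun x hx => ?_⟩
  obtain ⟨U, hV, s, rfl⟩ := (holomorphyPresheaf Z).exists_germ_eq x
  have hx' : IsUnit ((stalkToRing Z V).hom (((holomorphyPresheaf Z).germ U V hV).hom s)) := hx
  rw [stalkToRing_germ] at hx'
  obtain ⟨y, hy⟩ := hx'.exists_right_inv
  have hy' : s.1 ⟨V, hV⟩ * (y : F) = 1 := congrArg Subtype.val hy
  let U' : Opens (TopCat.of Z) :=
    U ⊓ ⟨{W | (y : F) ∈ W.1.ring}, (isOpen_setOf_mem (y : F)).preimage continuous_subtype_val⟩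
  have hV' : V ∈ U' := ⟨hV, y.2⟩
  let t : (holomorphyPresheaf Z).obj (op U') := ⟨fun _ => y, fun _ _ => rfl, fun W => W.2.2⟩
  let s' : (holomorphyPresheaf Z).obj (op U') := (holomorphyPresheaf Z).map (homOfLE inf_le_left).op s
  have hst : s' * t = 1 := by
    apply Subtype.ext
    funext W
    change s.1 ⟨W.1, W.2.1⟩ * (y : F) = 1
    rw [s.2.1 ⟨W.1, W.2.1⟩ ⟨V, hV⟩, hy']
  have hs' : IsUnit s' := IsUnit.of_mul_eq_one _ hst
  have e : ((holomorphyPresheaf Z).germ U' V hV').hom s' =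
      ((holomorphyPresheaf Z).germ U V hV).hom s :=
    TopCat.Presheaf.germ_res_apply (holomorphyPresheaf Z) (homOfLE inf_le_left) V hV' s
  exact e ▸ hs'.map ((holomorphyPresheaf Z).germ U' V hV').hom

/-- The stalks of the holomorphy sheaf are local rings. -/
lemma isLocalRing_stalk (V : TopCat.of Z) : IsLocalRing ((holomorphyPresheaf Z).stalk V) := by
  have hloc : IsLocalRing (CommRingCat.of V.1.ring) :=
    inferInstanceAs (IsLocalRing V.1.ring)
  exact RingHom.domain_isLocalRing (stalkToRing Z V).hom

variable (Z) in
/-- The subspace `Z` of the Zariski-Riemann space, with `F ∈ Z`, as a locally ringed space with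
the holomorphy sheaf as structure sheaf. -/
def locallyRingedSpace (hF : generic ∈ Z) : LocallyRingedSpace.{u} where
  carrier := TopCat.of Z
  presheaf := holomorphyPresheaf Z
  IsSheaf := holomorphyPresheaf_isSheaf hF
  isLocalRing := isLocalRing_stalk

variable (Z) in
/-- The inclusion of the holomorphy ring `A` into the ring of sections over an open subset of `Z`
(for empty open sets, the zero map). -/
def toSections (U : Opens (TopCat.of Z)) : holomorphyRing Z →+* holomorphySections Z U where
  toFun a := ⟨fun _ => a.1, fun _ _ => rfl, fun V => mem_holomorphyRing.1 a.2 V.1.1 V.1.2⟩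
  map_zero' := rfl
  map_add' _ _ := rfl
  map_one' := rfl
  map_mul' _ _ := rfl

variable (Z) in
/-- The structure morphism `Z ⟶ Spec A` of `Z` over its holomorphy ring `A`: the morphism that
corresponds to the inclusion of `A` in the ring of global sections of `Z`. On points it sends a
valuation ring to its center in `A` (see `mem_structureMorphism_iff`). -/
def structureMorphism (hF : generic ∈ Z) :
    locallyRingedSpace Z hF ⟶
      (Spec (CommRingCat.of (holomorphyRing Z))).toLocallyRingedSpace :=
  (locallyRingedSpace Z hF).toΓSpec ≫
    Spec.locallyRingedSpaceMap (CommRingCat.ofHom (toSections Z ⊤))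

/-- The structure morphism `Z ⟶ Spec A` sends `V` to the center of `V` in `A`, the prime ideal of
all elements of `A` that are not units of `V`. -/
lemma mem_structureMorphism_iff (hF : generic ∈ Z) (V : Z) (a : holomorphyRing Z) :
    a ∈ PrimeSpectrum.asIdeal ((structureMorphism Z hF).base V) ↔
      (⟨a.1, mem_holomorphyRing.1 a.2 V.1 V.2⟩ : V.1.ring) ∈ IsLocalRing.maximalIdeal V.1.ring := by
  have key : a ∉ PrimeSpectrum.asIdeal ((structureMorphism Z hF).base V) ↔
      IsUnit (((locallyRingedSpace Z hF).presheaf.Γgerm V).hom (toSections Z ⊤ a)) :=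
    LocallyRingedSpace.notMem_prime_iff_unit_in_stalk (locallyRingedSpace Z hF)
      (toSections Z ⊤ a) V
  have h2 : IsUnit (((locallyRingedSpace Z hF).presheaf.Γgerm V).hom (toSections Z ⊤ a)) ↔
      IsUnit (⟨a.1, mem_holomorphyRing.1 a.2 V.1 V.2⟩ : V.1.ring) := by
    have h3 := stalkToRing_germ V ⊤ trivial (toSections Z ⊤ a)
    constructor
    · intro h
      have := h.map (stalkToRing Z V).hom
      exact h3 ▸ this
    · intro h
      exact (isLocalHom_stalkToRing V).map_nonunit _ (h3.symm ▸ h)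
  rw [IsLocalRing.mem_maximalIdeal, mem_nonunits_iff, ← h2, ← key, not_not]

end ZariskiRiemann

attribute [local instance] MvPolynomial.gradedAlgebra

/-- The projective line `Proj A[T₀, T₁]` over a commutative ring `A`, with `A[T₀, T₁]` graded by
degree. -/
def ProjectiveLine (A : Type u) [CommRing A] : Scheme.{u} :=
  Proj (MvPolynomial.homogeneousSubmodule (Fin 2) A)

namespace ProjectiveLine

variable (A : Type u) [CommRing A]

/-- The structure morphism `ℙ¹_A ⟶ Spec A`. -/
def toSpec : ProjectiveLine A ⟶ Spec (CommRingCat.of A) :=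
  Proj.toSpecZero (MvPolynomial.homogeneousSubmodule (Fin 2) A) ≫
    Spec.map (CommRingCat.ofHom
      (algebraMap A (MvPolynomial.homogeneousSubmodule (Fin 2) A 0)))

variable {A}

/-- The open subscheme `(ℙ¹_A)_f` of points of the projective line at which the homogeneous
polynomial `f` does not vanish. -/
def basicOpen (f : MvPolynomial (Fin 2) A) : (ProjectiveLine A).Opens :=
  Proj.basicOpen (MvPolynomial.homogeneousSubmodule (Fin 2) A) f

end ProjectiveLine

/-- A Prüfer domain: an integral domain all of whose localizations at prime ideals are valuation
rings. -/
structure IsPruferDomain (A : Type u) [CommRing A] : Prop extends IsDomain A where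
  valuationRing_localization (P : Ideal A) [P.IsPrime] : ValuationRing (Localization.AtPrime P)

end

noncomputable section

attribute [local instance] MvPolynomial.gradedAlgebra

/-! ### Binary forms, Prüfer domains and torsion in the Picard group. -/

section BinaryForms

open MvPolynomial

/-! Both conditions amount to one statement about valuations, written multiplicatively: for every t
in F there is a binary form f over A of some degree d > 0 with v(f(1, t)) = max(1, v(t))^d for all V
in Z (`HasNonvanishingForm`). The inequality ≤ always holds; equality says that f does not vanish at
the center of V on the curve point (1 : t).

Geometry. Sending V to the center of (1 : t) is an A-morphism (`centerMap_comp_toSpec`), so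
condition 2 yields such forms (`hasNonvanishingForm_of_forall_hom`). Conversely, any A-morphism has
coordinates in F at the generic point. Sections over Z are constant elements of F, so these
coordinates, rescaled, also describe the image of each V. A form fitting them is nonzero on the
whole image (`exists_range_subset_basicOpen`).

Algebra. Given f, put x = f(1, t)⁻¹. The elements x, xt, ..., xt^d lie in A and generate the unit
ideal (`HasNonvanishingForm.exists_monomials_mem`), which gives both F = Frac A and the Prüfer
property. Combining forms over a set of generators shows that a power of each nonzero finitely
generated submodule of F is principal, so Pic A is torsion. Conversely, over a Prüfer domain (1, t)
is invertible, and torsion makes some power (1, t)^d = uA. As (1, t)^d consists of the values at (1,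
t) of forms of degree d, the generator u is the value of the required form. -/

lemma span_range_pow_eq_map_homogeneousSubmodule {σ R S : Type*} [CommRing R] [CommRing S]
    [Algebra R S] (x : σ → S) (d : ℕ) :
    Submodule.span R (Set.range x) ^ d =
      (homogeneousSubmodule σ R d).map (aeval x).toLinearMap := by
  rw [← homogeneousSubmodule_one_pow, Submodule.map_pow, homogeneousSubmodule_one_eq_span_X,
    Submodule.map_span, ← Set.range_comp]
  congr 3
  ext j
  simp

lemma MvPolynomial.eval₂_const_mul_of_isHomogeneous {σ R S : Type*} [CommRing R] [CommRing S]
    (φ : R →+* S) (c : S) (x : σ → S) {d : ℕ} {f : MvPolynomial σ R} (hf : f.IsHomogeneous d) :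
    eval₂ φ (fun j => c * x j) f = c ^ d * eval₂ φ x f := by
  rw [eval₂_eq, eval₂_eq, Finset.mul_sum]
  refine Finset.sum_congr rfl fun m hm => ?_
  rw [mul_left_comm, hf.degree_eq_sum_deg_support hm, Finset.prod_congr rfl fun i _ =>
    mul_pow c (x i) (m i), Finset.prod_mul_distrib, Finset.prod_pow_eq_pow_sum]

variable {F : Type*} [Field F] {A : Subring F}

lemma ValuationSubring.valuation_le_pow_of_mem_pow {V : ValuationSubring F}
    (hAV : A ≤ V.toSubring) {I : Submodule A F} {γ : V.ValueGroup}
    (hI : ∀ y ∈ I, V.valuation y ≤ γ) (d : ℕ) {z : F} (hz : z ∈ I ^ d) :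
    V.valuation z ≤ γ ^ d := by
  induction d generalizing z with
  | zero =>
    rw [pow_zero, Submodule.mem_one] at hz
    obtain ⟨a, rfl⟩ := hz
    rw [pow_zero, ValuationSubring.valuation_le_one_iff]
    exact hAV a.2
  | succ d ih =>
    rw [pow_succ] at hz ⊢
    refine Submodule.mul_induction_on hz (fun m hm n hn => ?_) fun a b ha hb => ?_
    · rw [map_mul]
      exact mul_le_mul' (ih hm) (hI n hn)
    · exact (V.valuation.map_add a b).trans (max_le ha hb)

lemma ValuationSubring.valuation_le_of_mem_span {V : ValuationSubring F}
    (hAV : A ≤ V.toSubring) {s : Set F} {γ : V.ValueGroup}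
    (hs : ∀ y ∈ s, V.valuation y ≤ γ) {z : F} (hz : z ∈ Submodule.span A s) :
    V.valuation z ≤ γ := by
  induction hz using Submodule.span_induction with
  | mem x hx => exact hs x hx
  | zero => simp
  | add x y _ _ hx hy => exact (V.valuation.map_add x y).trans (max_le hx hy)
  | smul a x _ hx =>
    have ha : V.valuation (a : F) ≤ 1 := (V.valuation_le_one_iff _).2 (hAV a.2)
    calc V.valuation (a • x) = V.valuation (a : F) * V.valuation x := map_mul _ _ _
      _ ≤ 1 * γ := mul_le_mul' ha hx
      _ = γ := one_mul γ

/-- The value of a form of degree d lies in the d-th power of the module spanned by the coordinates.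
Hence nonvanishing is only ever a question of the lower bound. -/
lemma ValuationSubring.valuation_aeval_le {V : ValuationSubring F} (hAV : A ≤ V.toSubring)
    {σ : Type*} {x : σ → F} {γ : V.ValueGroup} (hx : ∀ j, V.valuation (x j) ≤ γ) {d : ℕ}
    {f : MvPolynomial σ A} (hf : f.IsHomogeneous d) : V.valuation (aeval x f) ≤ γ ^ d :=
  valuation_le_pow_of_mem_pow hAV
    (I := Submodule.span A (Set.range x))
    (fun _ hy => valuation_le_of_mem_span hAV (by rintro _ ⟨j, rfl⟩; exact hx j) hy) d
    (span_range_pow_eq_map_homogeneousSubmodule (R := A) x d ▸ ⟨f, hf, rfl⟩)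

variable {ι : Type*} (V : ι → ValuationSubring F) (A)

/-- There is a binary form over `A` of positive degree that vanishes at the point `(1 : t)` modulo
none of the maximal ideals of the valuation rings `V i`. -/
def HasNonvanishingForm (t : F) : Prop :=
  ∃ (d : ℕ) (f : MvPolynomial (Fin 2) A), 0 < d ∧ f.IsHomogeneous d ∧
    ∀ i, (V i).valuation (aeval ![1, t] f) = max 1 ((V i).valuation t) ^ d

/-- Some power of the `A`-submodule `I` of `F` has an element that generates this power after
extension to each of the valuation rings `V i`. -/
def HasLocallyPrincipalPower (I : Submodule A F) : Prop :=
  ∃ (d : ℕ) (u : F), 0 < d ∧ u ≠ 0 ∧ u ∈ I ^ d ∧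
    ∀ i, ∃ γ : (V i).ValueGroup, (∀ y ∈ I, (V i).valuation y ≤ γ) ∧ (V i).valuation u = γ ^ d

variable {A V}

lemma ValuationSubring.valuation_binary_le (W : ValuationSubring F) (t : F) (j : Fin 2) :
    W.valuation ((![1, t] : Fin 2 → F) j) ≤ max 1 (W.valuation t) := by
  fin_cases j <;> simp

lemma HasNonvanishingForm.exists_monomials_mem [Nonempty ι]
    (hA : ∀ a, a ∈ A ↔ ∀ i, a ∈ V i) {t : F} (h : HasNonvanishingForm A V t) :
    ∃ (d : ℕ) (x : F), 0 < d ∧ (∀ i ≤ d, x * t ^ i ∈ A) ∧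
      (1 : F) ∈ Submodule.span A ((fun i => x * t ^ i) '' Set.Iic d) := by
  obtain ⟨d, f, hd, hf, h⟩ := h
  have hu : aeval ![1, t] f ≠ 0 := by
    obtain ⟨i⟩ := ‹Nonempty ι›
    rw [← (V i).valuation.ne_zero_iff, h i]
    exact pow_ne_zero _ (lt_of_lt_of_le zero_lt_one (le_max_left _ _)).ne'
  -- Membership in A follows from v(t)^i ≤ max(1, v(t))^d for i ≤ d; the relation for 1 is the
  -- expansion of x * f(1, t) = 1 into monomials.
  refine ⟨d, (aeval ![1, t] f)⁻¹, hd, fun i hi => (hA _).2 fun j => ?_, ?_⟩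
  · rw [← (V j).valuation_le_one_iff, map_mul, map_inv₀, map_pow, h j]
    have h0 : (0 : (V j).ValueGroup) < max 1 ((V j).valuation t) ^ d :=
      pow_pos (lt_of_lt_of_le zero_lt_one (le_max_left _ _)) _
    rw [mul_comm, ← div_eq_mul_inv, div_le_one₀ h0]
    exact (pow_le_pow_left₀ zero_le (le_max_right _ _) i).trans
      (pow_le_pow_right₀ (le_max_left _ _) hi)
  · have h1 := inv_mul_cancel₀ hu
    generalize (aeval ![1, t] f)⁻¹ = x at h1 ⊢
    rw [← h1, aeval_def, eval₂_eq, Finset.mul_sum]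
    refine Submodule.sum_mem _ fun m hm => ?_
    have hdeg : m 0 + m 1 = d := by
      rw [← hf (mem_support_iff.1 hm)]
      simp [Finsupp.weight_apply, Finsupp.sum_fintype]
    rw [mul_left_comm, ← Algebra.smul_def]
    refine Submodule.smul_mem _ _ (Submodule.subset_span ⟨m 1, ?_, ?_⟩)
    · exact (Nat.le_add_left _ _).trans hdeg.le
    · have : ∏ i ∈ m.support, (![1, t] : Fin 2 → F) i ^ m i =
          ∏ i, (![1, t] : Fin 2 → F) i ^ m i :=
        Finset.prod_subset (Finset.subset_univ _) fun i _ hi => by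
          rw [Finsupp.notMem_support_iff.1 hi, pow_zero]
      simp [this]

/-- Since d ≥ 1, both x and xt lie in A, and t = xt / x. -/
lemma isFractionRing_of_monomials
    (h : ∀ t : F, ∃ (d : ℕ) (x : F), 0 < d ∧ (∀ i ≤ d, x * t ^ i ∈ A) ∧
      (1 : F) ∈ Submodule.span A ((fun i => x * t ^ i) '' Set.Iic d)) :
    IsFractionRing A F := by
  refine IsFractionRing.of_field A F fun t => ?_
  obtain ⟨d, x, hd, hx, h1⟩ := h t
  have hx0 : x ≠ 0 := by
    rintro rfl
    have : (fun i => (0 : F) * t ^ i) '' Set.Iic d ⊆ {0} := by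
      rintro _ ⟨i, -, rfl⟩
      simp
    have h1 := Submodule.span_mono (R := A) this h1
    rw [Submodule.span_zero_singleton] at h1
    exact one_ne_zero ((Submodule.mem_bot A).1 h1)
  refine ⟨⟨x * t ^ 1, hx 1 hd⟩, ⟨x * t ^ 0, hx 0 (Nat.zero_le _)⟩, ?_⟩
  change t = x * t ^ 1 / (x * t ^ 0)
  rw [pow_one, pow_zero, mul_one, mul_div_cancel_left₀ _ hx0]

/-- For t = b/a some s = xt^i lies outside a given prime P, as these elements generate the unit
ideal. A neighbouring monomial is again in A, and it shows that a divides s * b or b divides s * a,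
so A_P is a valuation ring. -/
lemma isPruferDomain_of_monomials
    (h : ∀ t : F, ∃ (d : ℕ) (x : F), 0 < d ∧ (∀ i ≤ d, x * t ^ i ∈ A) ∧
      (1 : F) ∈ Submodule.span A ((fun i => x * t ^ i) '' Set.Iic d)) :
    IsPruferDomain A where
  valuationRing_localization P hP := by
    have := IsLocalization.isDomain_localization (M := P.primeCompl)
      P.primeCompl_le_nonZeroDivisors
    suffices key : ∀ a b : A, ∃ s ∉ P, a ∣ s * b ∨ b ∣ s * a by
      have dvd_of {a b s : A} (hs : s ∉ P) (h : a ∣ s * b) (p q : P.primeCompl) :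
          IsLocalization.mk' (Localization.AtPrime P) a p ∣ IsLocalization.mk' _ b q := by
        obtain ⟨c, hc⟩ := h
        refine ⟨IsLocalization.mk' _ (c * p) (⟨s, hs⟩ * q), ?_⟩
        rw [← IsLocalization.mk'_mul, IsLocalization.mk'_eq_iff_eq]
        congr 1
        push_cast
        linear_combination (p : A) * q * hc
      refine ValuationRing.iff_dvd_total.2 ⟨fun x y => ?_⟩
      obtain ⟨a, p, rfl⟩ := IsLocalization.exists_mk'_eq P.primeCompl x
      obtain ⟨b, q, rfl⟩ := IsLocalization.exists_mk'_eq P.primeCompl y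
      obtain ⟨s, hs, h | h⟩ := key a b
      exacts [.inl (dvd_of hs h p q), .inr (dvd_of hs h q p)]
    intro a b
    rcases eq_or_ne a 0 with rfl | ha
    · exact ⟨1, fun h1 => hP.ne_top ((Ideal.eq_top_iff_one P).2 h1), .inr (by simp)⟩
    have ha' : (a : F) ≠ 0 := fun h0 => ha (Subtype.ext h0)
    obtain ⟨d, x, hd, hx, h1⟩ := h (b / a : F)
    obtain ⟨i, hi, hiP⟩ : ∃ i, ∃ hi : i ≤ d, (⟨_, hx i hi⟩ : A) ∉ P := by
      by_contra! hcon
      have hle : Submodule.span A ((fun i => x * (b / a : F) ^ i) '' Set.Iic d) ≤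
          Submodule.map (Algebra.linearMap A F) P := by
        refine Submodule.span_le.2 ?_
        rintro _ ⟨i, hi, rfl⟩
        exact ⟨_, hcon i hi, rfl⟩
      obtain ⟨c, hc, hc1⟩ := hle h1
      have : c = 1 := Subtype.ext hc1
      exact hP.ne_top ((Ideal.eq_top_iff_one P).2 (this ▸ hc))
    refine ⟨_, hiP, ?_⟩
    -- For i < d the neighbour is xt^(i+1); for i = d it is xt^(d-1), which exists because d > 0.
    rcases hi.lt_or_eq with hlt | rfl
    · refine .inl ⟨⟨_, hx (i + 1) hlt⟩, Subtype.ext ?_⟩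
      change x * (b / a : F) ^ i * b = a * (x * (b / a : F) ^ (i + 1))
      rw [pow_succ]
      field_simp
    · obtain ⟨j, rfl⟩ := Nat.exists_eq_succ_of_ne_zero hd.ne'
      refine .inr ⟨⟨_, hx j (Nat.le_succ j)⟩, Subtype.ext ?_⟩
      change x * (b / a : F) ^ (j + 1) * a = b * (x * (b / a : F) ^ j)
      rw [pow_succ]
      field_simp

/-- The elements u^e and w^d generate I^(de) and J^(de) locally. A form f of degree k fitted to
their ratio gives f(u^e, w^d), whose value is the larger of the two values to the power k; it
therefore generates (I ⊔ J)^(dek) locally. -/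
lemma HasLocallyPrincipalPower.sup [Nonempty ι]
    (h : ∀ t, HasNonvanishingForm A V t) {I J : Submodule A F}
    (hI : HasLocallyPrincipalPower A V I) (hJ : HasLocallyPrincipalPower A V J) :
    HasLocallyPrincipalPower A V (I ⊔ J) := by
  obtain ⟨d, u, hd, hu, huI, hI⟩ := hI
  obtain ⟨e, w, he, hw, hwJ, hJ⟩ := hJ
  obtain ⟨k, f, hk, hf, h⟩ := h (w ^ d / u ^ e)
  have hue : u ^ e ≠ 0 := pow_ne_zero _ hu
  have val : ∀ i, (V i).valuation ((u ^ e) ^ k * aeval ![1, w ^ d / u ^ e] f) =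
      max ((V i).valuation u ^ e) ((V i).valuation w ^ d) ^ k := by
    intro i
    have h0 : (V i).valuation u ^ e ≠ 0 := pow_ne_zero _ ((V i).valuation.ne_zero_iff.2 hu)
    rw [map_mul, h i, map_pow, map_pow, ← mul_pow, mul_max, mul_one,
      map_div₀, map_pow, map_pow, mul_div_cancel₀ _ h0]
  refine ⟨d * e * k, (u ^ e) ^ k * aeval ![1, w ^ d / u ^ e] f, by positivity, ?_, ?_,
    fun i => ?_⟩
  · obtain ⟨i⟩ := ‹Nonempty ι›
    rw [← (V i).valuation.ne_zero_iff, val i]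
    exact pow_ne_zero _ (lt_of_lt_of_le (pow_pos
      (zero_lt_iff.2 ((V i).valuation.ne_zero_iff.2 hu)) _) (le_max_left _ _)).ne'
  · have huw : (fun j => u ^ e * (![1, w ^ d / u ^ e] : Fin 2 → F) j) = ![u ^ e, w ^ d] := by
      ext j
      fin_cases j
      · simp
      · simp [mul_div_cancel₀ _ hue]
    rw [aeval_def, ← eval₂_const_mul_of_isHomogeneous _ _ _ hf, huw, ← aeval_def, pow_mul]
    have hz : aeval ![u ^ e, w ^ d] f ∈ Submodule.span A (Set.range ![u ^ e, w ^ d]) ^ k :=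
      span_range_pow_eq_map_homogeneousSubmodule (R := A) ![u ^ e, w ^ d] k ▸ ⟨f, hf, rfl⟩
    have h_left : I ^ d ≤ (I ⊔ J) ^ d := pow_left_mono d le_sup_left
    have h_right : J ^ e ≤ (I ⊔ J) ^ e := pow_left_mono e le_sup_right
    refine pow_left_mono k (Submodule.span_le.2 ?_) hz
    rintro _ ⟨j, rfl⟩
    fin_cases j
    · exact pow_mul (I ⊔ J) d e ▸
        Submodule.pow_mem_pow _ (h_left huI) e
    · exact (mul_comm d e ▸ pow_mul (I ⊔ J) e d) ▸
        Submodule.pow_mem_pow _ (h_right hwJ) d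
  · obtain ⟨γ, hγ, hγu⟩ := hI i
    obtain ⟨δ, hδ, hδw⟩ := hJ i
    refine ⟨max γ δ, fun y hy => ?_, ?_⟩
    · obtain ⟨a, ha, b, hb, rfl⟩ := Submodule.mem_sup.1 hy
      exact ((V i).valuation.map_add a b).trans (max_le_max (hγ a ha) (hδ b hb))
    · rw [val i, hγu, hδw, ← pow_mul, ← pow_mul, mul_comm e d, pow_mul _ (d * e)]
      congr 1
      exact ((pow_left_mono (d * e)).map_max).symm

lemma hasLocallyPrincipalPower_of_fg [Nonempty ι] (h : ∀ t, HasNonvanishingForm A V t)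
    (hAV : ∀ i, A ≤ (V i).toSubring) {I : Submodule A F} (hI : I.FG) :
    I = ⊥ ∨ HasLocallyPrincipalPower A V I := by
  induction I, hI using Submodule.fg_induction with
  | singleton x =>
    rcases eq_or_ne x 0 with rfl | hx
    · exact .inl (Submodule.span_zero_singleton A)
    · refine .inr ⟨1, x, one_pos, hx, ?_, fun i => ⟨(V i).valuation x, fun y hy => ?_, ?_⟩⟩
      · rw [pow_one]
        exact Submodule.mem_span_singleton_self x
      · exact ValuationSubring.valuation_le_of_mem_span (hAV i) (by rintro _ rfl; exact le_rfl) hy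
      · rw [pow_one]
  | sup I J _ _ hI hJ =>
    rcases hI with rfl | hI
    · rwa [bot_sup_eq]
    · rcases hJ with rfl | hJ
      · rw [sup_bot_eq]
        exact .inr hI
      · exact .inr (hI.sup h hJ)

/-- If z lies in I^d, then v(z) ≤ γ^d = v(u) for every V, so z / u lies in all the V and hence in
their intersection A. -/
lemma HasLocallyPrincipalPower.exists_pow_eq_span_singleton
    (hA : ∀ a, a ∈ A ↔ ∀ i, a ∈ V i) {I : Submodule A F} (hI : HasLocallyPrincipalPower A V I) :
    ∃ (d : ℕ) (u : F), 0 < d ∧ u ≠ 0 ∧ I ^ d = Submodule.span A {u} := by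
  obtain ⟨d, u, hd, hu, huI, h⟩ := hI
  refine ⟨d, u, hd, hu, le_antisymm (fun z hz => ?_) ?_⟩
  · refine Submodule.mem_span_singleton.2 ⟨⟨z / u, (hA _).2 fun i => ?_⟩, div_mul_cancel₀ z hu⟩
    obtain ⟨γ, hγ, hγu⟩ := h i
    rw [← ValuationSubring.valuation_le_one_iff, map_div₀,
      div_le_one₀ (zero_lt_iff.2 ((V i).valuation.ne_zero_iff.2 hu)), hγu]
    exact ValuationSubring.valuation_le_pow_of_mem_pow (fun a ha => (hA a).1 ha i) hγ d hz
  · rwa [Submodule.span_singleton_le_iff_mem]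

open scoped nonZeroDivisors

lemma isMulTorsion_pic_of_hasNonvanishingForm [Nonempty ι] [IsFractionRing A F]
    (hA : ∀ a, a ∈ A ↔ ∀ i, a ∈ V i) (h : ∀ t, HasNonvanishingForm A V t) :
    IsMulTorsion (CommRing.Pic A) := by
  refine IsMulTorsion.of_surjective (f := (ClassGroup.equivPic A).toMonoidHom)
    (ClassGroup.equivPic A).surjective fun c => ?_
  refine ClassGroup.induction F (fun I => ?_) c
  have hbot : ((I : FractionalIdeal A⁰ F) : Submodule A F) ≠ ⊥ := fun h0 =>
    I.ne_zero (FractionalIdeal.coeToSubmodule_injective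
      (h0.trans FractionalIdeal.coe_zero.symm))
  obtain ⟨d, u, hd, hu, hI⟩ := ((hasLocallyPrincipalPower_of_fg h
    (fun i a ha => (hA a).1 ha i) (FractionalIdeal.fg_unit I)).resolve_left
      hbot).exists_pow_eq_span_singleton hA
  refine isOfFinOrder_iff_pow_eq_one.2 ⟨d, hd, ?_⟩
  rw [← map_pow, ClassGroup.mk_eq_one_iff]
  refine ⟨u, ?_⟩
  rw [Units.val_pow_eq_pow_val, FractionalIdeal.coe_pow, hI]

lemma exists_fractionalIdeal_unit_of_isPruferDomain [IsFractionRing A F] (hA : IsPruferDomain A)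
    (t : F) : ∃ I : (FractionalIdeal A⁰ F)ˣ,
      ((I : FractionalIdeal A⁰ F) : Submodule A F) = Submodule.span A (Set.range ![1, t]) := by
  have hfg : (Submodule.span A (Set.range ![1, t])).FG :=
    Submodule.fg_span (Set.finite_range _)
  let I : FractionalIdeal A⁰ F := ⟨_, FractionalIdeal.isFractional_of_fg hfg⟩
  have h1 : (1 : F) ∈ I := Submodule.subset_span ⟨0, rfl⟩
  have ht : t ∈ I := Submodule.subset_span ⟨1, rfl⟩
  have hI0 : I ≠ 0 := by
    intro h0
    rw [h0, FractionalIdeal.mem_zero_iff] at h1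
    exact one_ne_zero h1
  have mem_inv {x : F} (hx : x ∈ A) (hxt : x * t ∈ A) : x ∈ I⁻¹ := by
    rw [FractionalIdeal.mem_inv_iff hI0]
    intro y hy
    have hle : Submodule.span A (Set.range ![1, t]) ≤
        ((1 : FractionalIdeal A⁰ F) : Submodule A F).comap (LinearMap.mulLeft A x) := by
      refine Submodule.span_le.2 ?_
      rintro _ ⟨j, rfl⟩
      refine (FractionalIdeal.mem_one_iff A⁰).2 ?_
      fin_cases j
      · exact ⟨⟨x, hx⟩, (mul_one x).symm⟩
      · exact ⟨⟨x * t, hxt⟩, rfl⟩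
    exact hle hy
  -- The product I * I⁻¹ is an ideal J of A. If J lay in a maximal ideal P, write t = p / q: in the
  -- valuation ring A_P one of p, q divides the other, and clearing the denominator s outside P puts
  -- s into J.
  suffices hII : I * I⁻¹ = 1 from ⟨Units.mkOfMulEqOne I I⁻¹ hII, rfl⟩
  obtain ⟨J, hJ⟩ := FractionalIdeal.le_one_iff_exists_coeIdeal.1
    (FractionalIdeal.mul_one_div_le_one (I := I))
  rw [← FractionalIdeal.inv_eq] at hJ
  have mem_J {y x : F} (hy : y ∈ I) (hx : x ∈ I⁻¹) {s : A} (hs : (s : F) = y * x) : s ∈ J := by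
    have : algebraMap A F s ∈ (J : FractionalIdeal A⁰ F) := by
      rw [hJ, show algebraMap A F s = y * x from hs]
      exact FractionalIdeal.mul_mem_mul hy hx
    obtain ⟨s', hs', e⟩ := (FractionalIdeal.mem_coeIdeal A⁰).1 this
    rwa [← IsFractionRing.injective A F e]
  suffices J = ⊤ by rw [← hJ, this, FractionalIdeal.coeIdeal_top]
  by_contra hJt
  obtain ⟨P, hP, hJP⟩ := Ideal.exists_le_maximal J hJt
  have := hP.isPrime
  have := hA.valuationRing_localization P
  obtain ⟨p, q, hq, rfl⟩ := IsFractionRing.div_surjective (A := A) t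
  have hq0 : (q : F) ≠ 0 := fun h0 => nonZeroDivisors.ne_zero hq (Subtype.ext h0)
  have dvd {a b : A} (h : algebraMap A (Localization.AtPrime P) a ∣ algebraMap A _ b) :
      ∃ s ∉ P, ∃ r, b * s = a * r := by
    obtain ⟨c, hc⟩ := h
    obtain ⟨r, s, rfl⟩ := IsLocalization.exists_mk'_eq P.primeCompl c
    rw [← IsLocalization.mk'_one (M := P.primeCompl), ← IsLocalization.mk'_one (M := P.primeCompl),
      ← IsLocalization.mk'_mul, IsLocalization.mk'_eq_iff_eq] at hc
    refine ⟨s, s.2, r, ?_⟩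
    have := IsLocalization.injective (Localization.AtPrime P) P.primeCompl_le_nonZeroDivisors hc
    simpa [mul_comm] using this
  rcases (ValuationRing.iff_dvd_total.1 this).total (algebraMap A _ q) (algebraMap A _ p) with h | h
  · obtain ⟨s, hs, r, hr⟩ := dvd h
    have hr' : (p : F) * s = q * r := congrArg Subtype.val hr
    refine hs (hJP (mem_J h1 (mem_inv s.2 ?_) (one_mul _).symm))
    convert r.2 using 1
    change (s : F) * (p / q) = r
    field_simp
    linear_combination hr'
  · obtain ⟨s, hs, r, hr⟩ := dvd h
    have hr' : (q : F) * s = p * r := congrArg Subtype.val hr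
    have hs' : (s : F) = (p / q : F) * r := by
      field_simp
      linear_combination hr'
    refine hs (hJP (mem_J ht (mem_inv r.2 ?_) hs'))
    convert s.2 using 1
    rw [hs']
    exact mul_comm _ _

/-- Torsion makes (1, t)^d = uA with u = f(1, t). Both 1 and t^d are multiples of u, which is the
missing lower bound on v(u). -/
lemma hasNonvanishingForm_of_isPruferDomain [IsFractionRing A F]
    (hA : ∀ a, a ∈ A ↔ ∀ i, a ∈ V i) (hP : IsPruferDomain A)
    (hT : IsMulTorsion (CommRing.Pic A)) (t : F) : HasNonvanishingForm A V t := by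
  obtain ⟨I, hI⟩ := exists_fractionalIdeal_unit_of_isPruferDomain hP t
  have hfin : IsOfFinOrder (ClassGroup.mk (R := A) (K := F) I) :=
    IsMulTorsion.of_surjective (f := (ClassGroup.equivPic A).symm.toMonoidHom)
      (ClassGroup.equivPic A).symm.surjective hT _
  obtain ⟨d, hd, hId⟩ := isOfFinOrder_iff_pow_eq_one.1 hfin
  rw [← map_pow, ClassGroup.mk_eq_one_iff] at hId
  obtain ⟨u, hu⟩ := hId
  rw [Units.val_pow_eq_pow_val, FractionalIdeal.coe_pow, hI] at hu
  have huI : u ∈ Submodule.span A (Set.range ![1, t]) ^ d := hu ▸ Submodule.mem_span_singleton_self u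
  rw [span_range_pow_eq_map_homogeneousSubmodule] at huI
  obtain ⟨f, hf, rfl⟩ := huI
  refine ⟨d, f, hd, hf, fun i => le_antisymm (ValuationSubring.valuation_aeval_le
    (fun a ha => (hA a).1 ha i) ((V i).valuation_binary_le t) hf) ?_⟩
  have key (j : Fin 2) : (V i).valuation ((![1, t] : Fin 2 → F) j ^ d) ≤
      (V i).valuation (aeval ![1, t] f) :=
    ValuationSubring.valuation_le_of_mem_span (fun a ha => (hA a).1 ha i)
      (by rintro _ rfl; exact le_rfl)
      (hu ▸ Submodule.pow_mem_pow _ (Submodule.subset_span (Set.mem_range_self j)) d)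
  rw [(pow_left_mono d).map_max, one_pow]
  refine max_le ?_ ?_
  · simpa using key 0
  · simpa using key 1

end BinaryForms

/-! ### Maps from a homogeneous localization to a field. -/

namespace HomogeneousLocalization

variable {B σ : Type*} [CommRing B] [SetLike σ B] [AddSubgroupClass σ B] {𝒜 : ℕ → σ}
  [GradedRing 𝒜]

/-- The map from a homogeneous localization of a domain to a field induced by a ring homomorphism
that does not vanish at the homogeneous denominators. -/
def liftField [IsDomain B] {K : Type*} [Field K] (S : Submonoid B) (e : B →+* K)
    (h : ∀ i, ∀ s ∈ 𝒜 i, s ∈ S → e s ≠ 0) : HomogeneousLocalization 𝒜 S →+* K where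
  toFun y := Quotient.liftOn' y (fun c => e c.num / e c.den) fun c c' hc => by
    replace hc : Localization.mk c.num.1 ⟨c.den.1, c.den_mem⟩ =
      Localization.mk c'.num.1 ⟨c'.den.1, c'.den_mem⟩ := hc
    rw [Localization.mk_eq_mk_iff, Localization.r_iff_exists] at hc
    obtain ⟨s, hs⟩ := hc
    -- Zero is homogeneous and is killed by e, so it cannot be in S; equality of fractions then
    -- cancels in the domain B.
    have hs0 : (s : B) ≠ 0 := fun h0 =>
      h 0 0 (zero_mem _) (h0 ▸ s.2) (map_zero e)
    have hs := mul_left_cancel₀ hs0 hs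
    change e c.num / e c.den = e c'.num / e c'.den
    rw [div_eq_div_iff (h _ _ c.den.2 c.den_mem) (h _ _ c'.den.2 c'.den_mem), ← map_mul, ← map_mul,
      mul_comm c.num.1, mul_comm c'.num.1]
    exact congrArg e hs
  map_zero' := by
    change e 0 / e 1 = 0
    simp
  map_one' := by
    change e 1 / e 1 = 1
    simp
  map_add' x y := by
    obtain ⟨c, rfl⟩ := mk_surjective x
    obtain ⟨c', rfl⟩ := mk_surjective y
    change e (c + c').num / e (c + c').den = e c.num / e c.den + e c'.num / e c'.den
    rw [div_add_div _ _ (h _ _ c.den.2 c.den_mem) (h _ _ c'.den.2 c'.den_mem),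
      NumDenSameDeg.num_add, NumDenSameDeg.den_add, map_add, map_mul, map_mul, map_mul]
    ring
  map_mul' x y := by
    obtain ⟨c, rfl⟩ := mk_surjective x
    obtain ⟨c', rfl⟩ := mk_surjective y
    change e (c * c').num / e (c * c').den = e c.num / e c.den * (e c'.num / e c'.den)
    rw [NumDenSameDeg.num_mul, NumDenSameDeg.den_mul, map_mul, map_mul, div_mul_div_comm]

lemma liftField_mk [IsDomain B] {K : Type*} [Field K] (S : Submonoid B) (e : B →+* K)
    (h : ∀ i, ∀ s ∈ 𝒜 i, s ∈ S → e s ≠ 0) (c : NumDenSameDeg 𝒜 S) :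
    liftField S e h (mk c) = e c.num / e c.den := rfl

end HomogeneousLocalization

/-! ### The structure morphism of the projective line in terms of global sections. -/

namespace AlgebraicGeometry.Proj

variable {B : Type u} {σ : Type*} [CommRing B] [SetLike σ B] [AddSubgroupClass σ B] (𝒜 : ℕ → σ)
  [GradedRing 𝒜]

/-- The homogeneous elements of degree zero as global sections of the structure sheaf. -/
def zeroToGlobal : CommRingCat.of (𝒜 0) ⟶ Γ(Proj 𝒜, ⊤) :=
  CommRingCat.ofHom (HomogeneousLocalization.fromZeroRingHom 𝒜 _) ≫ awayToSection 𝒜 1 ≫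
    (Proj 𝒜).presheaf.map (homOfLE (basicOpen_one 𝒜).ge).op

/-- The open set where 1 does not vanish is everything. This form of the morphism makes the
adjunction between Γ and Spec applicable. -/
lemma toSpecZero_eq : toSpecZero 𝒜 = (Proj 𝒜).toSpecΓ ≫ Spec.map (zeroToGlobal 𝒜) := by
  have hU : basicOpen 𝒜 1 = ⊤ := basicOpen_one _
  let g : Proj 𝒜 ⟶ (basicOpen 𝒜 1).toScheme :=
    (Scheme.topIso _).inv ≫ (Scheme.isoOfEq _ hU).inv
  have hg : g ≫ (basicOpen 𝒜 1).ι = 𝟙 _ := by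
    simp [g]
  have h2 : CommRingCat.ofHom (HomogeneousLocalization.fromZeroRingHom 𝒜 _) ≫ awayToSection 𝒜 1 =
      zeroToGlobal 𝒜 ≫ (Proj 𝒜).presheaf.map (homOfLE (le_top : basicOpen 𝒜 1 ≤ ⊤)).op := by
    rw [zeroToGlobal, Category.assoc, Category.assoc, ← Functor.map_comp, ← op_comp]
    exact ((Category.comp_id _).symm.trans (congrArg _ ((Proj 𝒜).presheaf.map_id _).symm))
  calc toSpecZero 𝒜 = g ≫ (basicOpen 𝒜 1).toSpecΓ ≫ Spec.map (awayToSection 𝒜 1) ≫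
      Spec.map (CommRingCat.ofHom (HomogeneousLocalization.fromZeroRingHom 𝒜 _)) := by
        simp only [toSpecZero, basicOpenToSpec, Category.assoc, g]
    _ = (Proj 𝒜).toSpecΓ ≫ Spec.map (zeroToGlobal 𝒜) := by
      rw [← Spec.map_comp, h2, Spec.map_comp,
        Scheme.Opens.toSpecΓ_SpecMap_presheaf_map_top_assoc, reassoc_of% hg]

end AlgebraicGeometry.Proj

namespace ProjectiveLine

open MvPolynomial

variable (A : Type u) [CommRing A]

/-- The elements of `A` as global sections of the structure sheaf of the projective line. -/
def constGlobal : CommRingCat.of A ⟶ Γ(Proj (homogeneousSubmodule (Fin 2) A), ⊤) :=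
  CommRingCat.ofHom (algebraMap A (homogeneousSubmodule (Fin 2) A 0)) ≫ Proj.zeroToGlobal _

lemma toSpec_eq : toSpec A =
    (Proj (homogeneousSubmodule (Fin 2) A)).toSpecΓ ≫ Spec.map (constGlobal A) := by
  rw [constGlobal, Spec.map_comp, ← Category.assoc, ← Proj.toSpecZero_eq]
  rfl

lemma toSpec_toLRSHom : (toSpec A).toLRSHom =
    (Proj (homogeneousSubmodule (Fin 2) A)).toLocallyRingedSpace.toΓSpec ≫
      Spec.locallyRingedSpaceMap (constGlobal A) :=
  congrArg Scheme.Hom.toLRSHom (toSpec_eq A)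

end ProjectiveLine

/-- Naturality of the unit of the adjunction between Γ and Spec. -/
lemma AlgebraicGeometry.LocallyRingedSpace.comp_toΓSpec_comp {X Y : LocallyRingedSpace.{u}}
    (φ : X ⟶ Y) {R : CommRingCat.{u}} (g : R ⟶ LocallyRingedSpace.Γ.obj (op Y)) :
    φ ≫ Y.toΓSpec ≫ Spec.locallyRingedSpaceMap g =
      X.toΓSpec ≫ Spec.locallyRingedSpaceMap (g ≫ φ.c.app (op ⊤)) := by
  refine Eq.trans ?_ (congrArg (X.toΓSpec ≫ ·)
    (Spec.locallyRingedSpaceMap_comp g (LocallyRingedSpace.Γ.map φ.op)).symm)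
  exact (Category.assoc _ _ _).symm.trans
    ((congrArg (· ≫ _) (identityToΓSpec.naturality φ)).trans (Category.assoc _ _ _))

namespace ZariskiRiemann

variable {F : Type u} [Field F] {D : Subring F} {Z : Set (ZariskiRiemann D)}

open MvPolynomial

/-- Morphisms to Spec A correspond to ring maps from A to global sections, so being an A-morphism
can be tested on constants. -/
lemma comp_toSpec_eq_structureMorphism_iff (hF : generic ∈ Z)
    (φ : locallyRingedSpace Z hF ⟶
      (Proj (homogeneousSubmodule (Fin 2) (holomorphyRing Z))).toLocallyRingedSpace) :
    φ ≫ (ProjectiveLine.toSpec (holomorphyRing Z)).toLRSHom = structureMorphism Z hF ↔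
      ∀ a, (φ.c.app (op ⊤)).hom ((ProjectiveLine.constGlobal (holomorphyRing Z)).hom a) =
        toSections Z ⊤ a := by
  have h1 := LocallyRingedSpace.comp_toΓSpec_comp φ (ProjectiveLine.constGlobal _)
  rw [← ProjectiveLine.toSpec_toLRSHom] at h1
  refine (Eq.congr h1 rfl).trans ?_
  have h2 := (ΓSpec.locallyRingedSpaceAdjunction.homEquiv (locallyRingedSpace Z hF)
    (op (CommRingCat.of (holomorphyRing Z)))).injective
  constructor
  · intro h a
    have := Quiver.Hom.op_inj (h2 h)
    exact congrArg (fun f => f.hom a) this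
  · intro h
    congr 2
    ext a
    exact h a

end ZariskiRiemann

namespace ZariskiRiemann

variable {F : Type u} [Field F] {D : Subring F} {Z : Set (ZariskiRiemann D)}

/-! ### Constructing morphisms from Z to Proj. -/

section MorphismToProj

variable {B : Type u} {σ : Type*} [CommRing B] [IsDomain B] [SetLike σ B] [AddSubgroupClass σ B]
  {𝒜 : ℕ → σ} [GradedRing 𝒜]

/-- A continuous map `p` from `Z` to the projective spectrum of a graded ring is compatible with a
ring homomorphism `e` to `F` if `e` induces a local homomorphism from the homogeneous localization
at each point `p V` to `V`. -/
structure IsCompatible (e : B →+* F) (p : TopCat.of Z ⟶ TopCat.of (ProjectiveSpectrum 𝒜)) :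
    Prop where
  ne_zero : ∀ (V : Z) (i : ℕ), ∀ s ∈ 𝒜 i, s ∈ (p V).asHomogeneousIdeal.toIdeal.primeCompl → e s ≠ 0
  div_mem : ∀ (V : Z) (i : ℕ), ∀ r ∈ 𝒜 i, ∀ s ∈ 𝒜 i,
    s ∈ (p V).asHomogeneousIdeal.toIdeal.primeCompl → e r / e s ∈ V.1.ring
  isLocal : ∀ (V : Z) (i : ℕ), ∀ r ∈ 𝒜 i, ∀ s ∈ 𝒜 i,
    s ∈ (p V).asHomogeneousIdeal.toIdeal.primeCompl → e r ≠ 0 → e s / e r ∈ V.1.ring →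
    r ∈ (p V).asHomogeneousIdeal.toIdeal.primeCompl

variable {e : B →+* F} {p : TopCat.of Z ⟶ TopCat.of (ProjectiveSpectrum 𝒜)}

/-- The ring homomorphism from the homogeneous localization at `p V` to `F`. -/
def IsCompatible.valueAt (h : IsCompatible e p) (V : Z) :
    HomogeneousLocalization.AtPrime 𝒜 (p V).asHomogeneousIdeal.toIdeal →+* F :=
  HomogeneousLocalization.liftField _ e (h.ne_zero V)

lemma IsCompatible.valueAt_mem (h : IsCompatible e p) (V : Z)
    (y : HomogeneousLocalization.AtPrime 𝒜 (p V).asHomogeneousIdeal.toIdeal) :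
    h.valueAt V y ∈ V.1.ring := by
  obtain ⟨c, rfl⟩ := HomogeneousLocalization.mk_surjective y
  exact h.div_mem V _ _ c.num.2 _ c.den.2 c.den_mem

lemma IsCompatible.isUnit_of_valueAt (h : IsCompatible e p) (V : Z)
    (y : HomogeneousLocalization.AtPrime 𝒜 (p V).asHomogeneousIdeal.toIdeal)
    (hy0 : h.valueAt V y ≠ 0) (hy : (h.valueAt V y)⁻¹ ∈ V.1.ring) : IsUnit y := by
  obtain ⟨c, rfl⟩ := HomogeneousLocalization.mk_surjective y
  rw [valueAt, HomogeneousLocalization.liftField_mk] at hy hy0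
  rw [inv_div] at hy
  have hr := h.isLocal V _ _ c.num.2 _ c.den.2 c.den_mem (div_ne_zero_iff.1 hy0).1 hy
  refine IsUnit.of_mul_eq_one (HomogeneousLocalization.mk ⟨c.deg, c.den, c.num, hr⟩) ?_
  apply HomogeneousLocalization.val_injective
  rw [HomogeneousLocalization.val_mul, HomogeneousLocalization.val_mk,
    HomogeneousLocalization.val_mk, HomogeneousLocalization.val_one, Localization.mk_mul,
    ← Localization.mk_one, Localization.mk_eq_mk_iff, Localization.r_iff_exists]
  exact ⟨1, by simp [mul_comm]⟩

/-- The pullback of a section of the structure sheaf of the projective spectrum. -/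
def IsCompatible.pullbackSection (h : IsCompatible e p) (hF : generic ∈ Z)
    (U : Opens (ProjectiveSpectrum.top 𝒜)) :
    (ProjectiveSpectrum.Proj.structureSheaf 𝒜).1.obj (op U) →+*
      holomorphySections Z ((Opens.map p).obj U) where
  toFun s := ⟨fun V => h.valueAt V.1 (s.1 ⟨p V.1, V.2⟩), by
    -- Locally s is a fraction a / b, so its value is the constant e a / e b; constancy is a local
    -- condition because of the point F.
    refine (holomorphyLocalPredicate hF).locality _ fun V => ?_
    obtain ⟨W, hVW, i, n, a, b, hb, hs⟩ := s.2 ⟨p V.1, V.2⟩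
    refine ⟨(Opens.map p).obj W, hVW, (Opens.map p).map i, ?_⟩
    have key (W' : (Opens.map p).obj W) :
        h.valueAt W'.1 (s.1 ⟨p W'.1, leOfHom i W'.2⟩) = e a / e b :=
      congrArg (h.valueAt W'.1) (hs ⟨p W'.1, W'.2⟩)
    exact ⟨fun V' W' => (key V').trans (key W').symm, fun V' => h.valueAt_mem _ _⟩⟩
  map_zero' := Subtype.ext (funext fun V => map_zero (h.valueAt V.1))
  map_one' := Subtype.ext (funext fun V => map_one (h.valueAt V.1))
  map_add' _ _ := Subtype.ext (funext fun V => map_add (h.valueAt V.1) _ _)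
  map_mul' _ _ := Subtype.ext (funext fun V => map_mul (h.valueAt V.1) _ _)

/-- The morphism of presheafed spaces with underlying map `p`. -/
def IsCompatible.presheafedSpaceHom (h : IsCompatible e p) (hF : generic ∈ Z) :
    (locallyRingedSpace Z hF).toPresheafedSpace ⟶
      (Proj.toLocallyRingedSpace 𝒜).toPresheafedSpace where
  base := p
  c :=
    { app := fun U => CommRingCat.ofHom
        (R := (ProjectiveSpectrum.Proj.structureSheaf 𝒜).1.obj U)
        (S := holomorphySections Z ((Opens.map p).obj U.unop)) (h.pullbackSection hF U.unop)
      naturality := fun _ _ _ => rfl }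

/-- A germ with unit image has a value invertible in V. By compatibility its fraction is then a unit
of the homogeneous localization, which is the stalk of Proj. -/
lemma IsCompatible.isLocalHom_stalkMap (h : IsCompatible e p) (hF : generic ∈ Z) (V : Z) :
    IsLocalHom ((h.presheafedSpaceHom hF).stalkMap V).hom := by
  refine ⟨fun x hx => ?_⟩
  obtain ⟨U, hU, s, rfl⟩ :=
    (ProjectiveSpectrum.Proj.structureSheaf 𝒜).presheaf.exists_germ_eq x
  replace hU : p V ∈ U := hU
  have hgerm := PresheafedSpace.stalkMap_germ_apply (h.presheafedSpaceHom hF) U V hU s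
  have hx := hx.map (stalkToRing Z V).hom
  have hval : (stalkToRing Z V).hom (((h.presheafedSpaceHom hF).stalkMap V).hom
      (((ProjectiveSpectrum.Proj.structureSheaf 𝒜).presheaf.germ U (p V) hU).hom s)) =
      ⟨h.valueAt V (s.1 ⟨p V, hU⟩), h.valueAt_mem V _⟩ :=
    (congrArg (stalkToRing Z V).hom hgerm).trans
      (stalkToRing_germ V ((Opens.map p).obj U) hU (h.pullbackSection hF U s))
  obtain ⟨y, hy⟩ := (hval ▸ hx).exists_right_inv
  have hy : h.valueAt V (s.1 ⟨p V, hU⟩) * y.1 = 1 := congrArg Subtype.val hy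
  have hunit := h.isUnit_of_valueAt V _ (left_ne_zero_of_mul_eq_one hy)
    (inv_eq_of_mul_eq_one_right hy ▸ y.2)
  exact (MulEquiv.isUnit_map (Proj.stalkIso' 𝒜 (p V))).1
    ((congrArg IsUnit (Proj.stalkIso'_germ 𝒜 U (p V) hU s)).mpr hunit)

/-- The morphism of locally ringed spaces with underlying map `p`. -/
def IsCompatible.hom (h : IsCompatible e p) (hF : generic ∈ Z) :
    locallyRingedSpace Z hF ⟶ (Proj 𝒜).toLocallyRingedSpace :=
  LocallyRingedSpace.Hom.mk (Y := Proj.toLocallyRingedSpace 𝒜)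
    (h.presheafedSpaceHom hF) (h.isLocalHom_stalkMap hF)

end MorphismToProj

/-! ### Reading off coordinates in F from a given morphism. -/

section MorphismFromProj

variable {B : Type u} {σ : Type*} [CommRing B] [SetLike σ B] [AddSubgroupClass σ B]
  {𝒜 : ℕ → σ} [GradedRing 𝒜] {hF : generic ∈ Z}
  (φ : locallyRingedSpace Z hF ⟶ (Proj 𝒜).toLocallyRingedSpace)

/-- The image of `V` as a point of the projective spectrum. -/
def imagePoint (V : Z) : ProjectiveSpectrum 𝒜 := φ.base V

/-- The local homomorphism from the homogeneous localization at the image of `V` to `V`. -/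
def localPullback (V : Z) :
    HomogeneousLocalization.AtPrime 𝒜 (imagePoint φ V).asHomogeneousIdeal.toIdeal →+* V.1.ring :=
  (stalkToRing Z V).hom.comp ((φ.stalkMap V).hom.comp
    (Proj.stalkIso' 𝒜 (imagePoint φ V)).symm.toRingHom)

lemma localPullback_apply (V : Z) (U : Opens (ProjectiveSpectrum.top 𝒜)) (hU : imagePoint φ V ∈ U)
    (s : (ProjectiveSpectrum.Proj.structureSheaf 𝒜).1.obj (op U)) :
    (localPullback φ V (s.1 ⟨imagePoint φ V, hU⟩) : F) =
      ((φ.c.app (op U)).hom s : holomorphySections Z ((Opens.map φ.base).obj U)).1 ⟨V, hU⟩ := by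
  have hgerm := LocallyRingedSpace.stalkMap_germ_apply φ U V hU s
  have h1 : (Proj.stalkIso' 𝒜 (imagePoint φ V)).symm (s.1 ⟨imagePoint φ V, hU⟩) =
      (ProjectiveSpectrum.Proj.structureSheaf 𝒜).presheaf.germ U (imagePoint φ V) hU s := by
    rw [RingEquiv.symm_apply_eq]
    exact (Proj.stalkIso'_germ 𝒜 U _ hU s).symm
  have h2 : localPullback φ V (s.1 ⟨imagePoint φ V, hU⟩) = (stalkToRing Z V).hom
      ((φ.stalkMap V).hom ((Proj.stalkIso' 𝒜 (imagePoint φ V)).symm (s.1 ⟨_, hU⟩))) := rfl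
  rw [h2, h1]
  exact congrArg Subtype.val ((congrArg (stalkToRing Z V).hom hgerm).trans
    (stalkToRing_germ V ((Opens.map φ.base).obj U) hU ((φ.c.app (op U)).hom s)))

lemma isUnit_of_isUnit_localPullback (V : Z)
    (y : HomogeneousLocalization.AtPrime 𝒜 (imagePoint φ V).asHomogeneousIdeal.toIdeal)
    (hy : IsUnit (localPullback φ V y)) : IsUnit y := by
  have h1 := (isLocalHom_stalkToRing V).map_nonunit _ hy
  have h2 := (φ.prop V).map_nonunit _ h1
  exact (MulEquiv.isUnit_map (Proj.stalkIso' 𝒜 (imagePoint φ V)).symm).1 h2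

lemma generic_mem_preimage {V : Z} {U : Opens (ProjectiveSpectrum.top 𝒜)}
    (hU : imagePoint φ V ∈ U) : imagePoint φ ⟨generic, hF⟩ ∈ U := by
  obtain ⟨O, hO, h⟩ := isOpen_induced_iff.1 ((Opens.map φ.base).obj U).2
  have h1 : V ∈ Subtype.val ⁻¹' O := (Set.ext_iff.1 h V).2 hU
  exact (Set.ext_iff.1 h ⟨generic, hF⟩).1 (generic_mem_of_isOpen hO ⟨V.1, h1⟩)

/-- The homomorphism to `F` from the homogeneous localization at the image of the generic point. -/
def genericPullback :
    HomogeneousLocalization.AtPrime 𝒜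
      (imagePoint φ ⟨generic, hF⟩).asHomogeneousIdeal.toIdeal →+* F :=
  (generic : ZariskiRiemann D).ring.subtype.comp (localPullback φ ⟨generic, hF⟩)

/-- The fraction r / s is a section over the open set where s does not vanish. Its pullback is a
constant function, so its values at V and at the generic point agree. This transfers local
information at V to one computation in F. -/
lemma genericPullback_mk {V : Z} {i : ℕ} (r s : 𝒜 i)
    (hs : s.1 ∈ (imagePoint φ V).asHomogeneousIdeal.toIdeal.primeCompl) :
    genericPullback φ (.mk ⟨i, r, s, generic_mem_preimage φ (U := ProjectiveSpectrum.basicOpen 𝒜 s)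
      hs⟩) = localPullback φ V (.mk ⟨i, r, s, hs⟩) := by
  have h1 := localPullback_apply φ V (ProjectiveSpectrum.basicOpen 𝒜 s) hs
    (sectionInBasicOpen 𝒜 _ ⟨i, r, s, hs⟩)
  have h2 := localPullback_apply φ ⟨generic, hF⟩ (ProjectiveSpectrum.basicOpen 𝒜 s)
    (generic_mem_preimage φ hs) (sectionInBasicOpen 𝒜 _ ⟨i, r, s, hs⟩)
  refine h2.trans (Eq.trans ?_ h1.symm)
  exact Subtype.prop ((φ.c.app (op (ProjectiveSpectrum.basicOpen 𝒜 s.1))).hom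
    (sectionInBasicOpen 𝒜 _ ⟨i, r, s, hs⟩) :
    holomorphySections Z ((Opens.map φ.base).obj _)) |>.1 _ _

lemma valuation_genericPullback_le_one {V : Z} {i : ℕ} (r s : 𝒜 i)
    (hs : s.1 ∈ (imagePoint φ V).asHomogeneousIdeal.toIdeal.primeCompl) :
    V.1.ring.valuation (genericPullback φ (.mk ⟨i, r, s, generic_mem_preimage φ
      (U := ProjectiveSpectrum.basicOpen 𝒜 s) hs⟩)) ≤ 1 := by
  rw [genericPullback_mk φ r s hs]
  exact V.1.ring.valuation_le_one _

lemma mem_primeCompl_of_valuation_genericPullback {V : Z} {i : ℕ} (r s : 𝒜 i)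
    (hs : s.1 ∈ (imagePoint φ V).asHomogeneousIdeal.toIdeal.primeCompl)
    (h : V.1.ring.valuation (genericPullback φ (.mk ⟨i, r, s, generic_mem_preimage φ
      (U := ProjectiveSpectrum.basicOpen 𝒜 s) hs⟩)) = 1) :
    r.1 ∈ (imagePoint φ V).asHomogeneousIdeal.toIdeal.primeCompl := by
  rw [genericPullback_mk φ r s hs, ← ValuationSubring.valuation_eq_one_iff] at h
  have := isUnit_of_isUnit_localPullback φ V _ h
  rw [← HomogeneousLocalization.isUnit_iff_isUnit_val, HomogeneousLocalization.val_mk,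
    Localization.mk_eq_mk', IsLocalization.AtPrime.isUnit_mk'_iff
      (Localization.AtPrime (imagePoint φ V).asHomogeneousIdeal.toIdeal)] at this
  exact this

end MorphismFromProj

end ZariskiRiemann

/-! ### The center of a valuation ring at a point (1 : t). -/

section CenterOnProjectiveLine

open MvPolynomial

variable {F : Type u} [Field F]

namespace ValuationSubring

/-- A scalar that makes `(1, t)` a unimodular vector over the valuation ring `W`. -/
def scalar (W : ValuationSubring F) (t : F) : F :=
  open Classical in if t ∈ W then 1 else t⁻¹

lemma valuation_scalar_mul (W : ValuationSubring F) (t : F) :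
    W.valuation (W.scalar t) * max 1 (W.valuation t) = 1 := by
  unfold scalar
  split_ifs with h
  · rw [map_one, one_mul, max_eq_left ((W.valuation_le_one_iff t).2 h)]
  · have h1 : 1 < W.valuation t := not_le.1 fun h1 => h ((W.valuation_le_one_iff t).1 h1)
    rw [max_eq_right h1.le, map_inv₀, inv_mul_cancel₀ (zero_lt_one.trans h1).ne']

/-- The vector `(1, t)`, scaled to be unimodular over the valuation ring `W`. -/
def coordinate (W : ValuationSubring F) (t : F) (j : Fin 2) : W :=
  ⟨W.scalar t * (![1, t] : Fin 2 → F) j, by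
    rw [← valuation_le_one_iff, map_mul, ← W.valuation_scalar_mul t]
    exact mul_le_mul_right (W.valuation_binary_le t j) _⟩

variable {A : Subring F} {W : ValuationSubring F}

/-- The evaluation of binary forms at the closed point of `Spec W` of the point `(1 : t)` of the
projective line; the additional variable records the degree. -/
def gradedEval (hAW : A ≤ W.toSubring) (t : F) :
    MvPolynomial (Fin 2) A →+* Polynomial (IsLocalRing.ResidueField W) :=
  eval₂Hom (Polynomial.C.comp ((IsLocalRing.residue W).comp (Subring.inclusion hAW)))
    fun j => Polynomial.X * Polynomial.C (IsLocalRing.residue W (W.coordinate t j))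

lemma gradedEval_of_isHomogeneous (hAW : A ≤ W.toSubring) (t : F) {d : ℕ}
    {f : MvPolynomial (Fin 2) A} (hf : f.IsHomogeneous d) :
    gradedEval hAW t f = Polynomial.X ^ d * Polynomial.C
      (IsLocalRing.residue W (eval₂ (Subring.inclusion hAW) (W.coordinate t) f)) := by
  rw [gradedEval, coe_eval₂Hom, eval₂_const_mul_of_isHomogeneous _ _ _ hf,
    ← RingHom.comp_apply, eval₂_comp_left]
  rfl

lemma valuation_eval₂_coordinate (hAW : A ≤ W.toSubring) (t : F) {d : ℕ}
    {f : MvPolynomial (Fin 2) A} (hf : f.IsHomogeneous d) :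
    W.valuation (eval₂ (Subring.inclusion hAW) (W.coordinate t) f : W) *
      max 1 (W.valuation t) ^ d = W.valuation (aeval ![1, t] f) := by
  have h1 : ((eval₂ (Subring.inclusion hAW) (W.coordinate t) f : W) : F) =
      W.scalar t ^ d * aeval ![1, t] f := by
    rw [aeval_def, ← eval₂_const_mul_of_isHomogeneous _ _ _ hf]
    exact eval₂_comp_left W.subtype (Subring.inclusion hAW) (W.coordinate t) f
  rw [h1, map_mul, map_pow, mul_right_comm, ← mul_pow, valuation_scalar_mul, one_pow, one_mul]

lemma gradedEval_eq_zero_iff (hAW : A ≤ W.toSubring) (t : F) {d : ℕ}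
    {f : MvPolynomial (Fin 2) A} (hf : f.IsHomogeneous d) :
    gradedEval hAW t f = 0 ↔ W.valuation (aeval ![1, t] f) < max 1 (W.valuation t) ^ d := by
  have h0 : (0 : W.ValueGroup) < max 1 (W.valuation t) ^ d :=
    pow_pos (lt_of_lt_of_le zero_lt_one (le_max_left _ _)) _
  rw [gradedEval_of_isHomogeneous hAW t hf, mul_eq_zero,
    or_iff_right (pow_ne_zero _ Polynomial.X_ne_zero), Polynomial.C_eq_zero,
    IsLocalRing.residue_eq_zero_iff, W.valuation_lt_one_iff, ← valuation_eval₂_coordinate hAW t hf]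
  exact (mul_lt_iff_lt_one_left h0).symm

/-- The extra variable separates degrees: only the component of degree d contributes to the
coefficient of degree d. This makes the kernel a homogeneous ideal. -/
lemma coeff_gradedEval (hAW : A ≤ W.toSubring) (t : F) (f : MvPolynomial (Fin 2) A) (d : ℕ) :
    gradedEval hAW t (homogeneousComponent d f) =
      Polynomial.monomial d ((gradedEval hAW t f).coeff d) := by
  have key (i : ℕ) := gradedEval_of_isHomogeneous hAW t (homogeneousComponent_isHomogeneous i f)
  have hsum : (gradedEval hAW t f).coeff d =
      ∑ i ∈ Finset.range (f.totalDegree + 1),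
        (gradedEval hAW t (homogeneousComponent i f)).coeff d := by
    conv_lhs => rw [← sum_homogeneousComponent f, map_sum, Polynomial.finsetSum_coeff]
  have hcoeff (i : ℕ) (hi : i ≠ d) : (gradedEval hAW t (homogeneousComponent i f)).coeff d = 0 := by
    rw [key i, mul_comm, Polynomial.coeff_C_mul_X_pow, if_neg hi.symm]
  rw [hsum, Finset.sum_eq_single d (fun i _ hi => hcoeff i hi), key d, mul_comm,
    Polynomial.coeff_C_mul_X_pow, if_pos rfl, Polynomial.C_mul_X_pow_eq_monomial]
  intro hd
  rw [homogeneousComponent_eq_zero, map_zero, Polynomial.coeff_zero]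
  simpa using hd

/-- The center on the projective line over `A` of the valuation ring `W` at the point `(1 : t)`. -/
def center (hAW : A ≤ W.toSubring) (t : F) :
    ProjectiveSpectrum (homogeneousSubmodule (Fin 2) A) where
  asHomogeneousIdeal := ⟨RingHom.ker (gradedEval hAW t), fun d f hf => by
    refine (congrArg (gradedEval hAW t) (decomposition.decompose'_apply f d)).trans ?_
    rw [coeff_gradedEval, RingHom.mem_ker.1 hf, Polynomial.coeff_zero, map_zero]⟩
  isPrime := RingHom.ker_isPrime _
  not_irrelevant_le h := by
    have key (j : Fin 2) :
        W.valuation ((![1, t] : Fin 2 → F) j) < max 1 (W.valuation t) := by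
      have h1 : (X j : MvPolynomial (Fin 2) A) ∈
          HomogeneousIdeal.irrelevant (homogeneousSubmodule (Fin 2) A) :=
        HomogeneousIdeal.mem_irrelevant_of_mem _ one_pos (isHomogeneous_X A j)
      simpa using (gradedEval_eq_zero_iff hAW t (isHomogeneous_X A j)).1 (h h1)
    -- Whichever of 1 and t attains the maximum, the corresponding variable does not vanish at the
    -- center.
    rcases max_choice 1 (W.valuation t) with h1 | h1
    · exact (key 0).ne (by simp [h1])
    · exact (key 1).ne (by simp [h1])

lemma mem_primeCompl_center_iff (hAW : A ≤ W.toSubring) (t : F) {d : ℕ}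
    {f : MvPolynomial (Fin 2) A} (hf : f.IsHomogeneous d) :
    f ∈ (center hAW t).asHomogeneousIdeal.toIdeal.primeCompl ↔
      W.valuation (aeval ![1, t] f) = max 1 (W.valuation t) ^ d := by
  refine (not_congr (gradedEval_eq_zero_iff hAW t hf)).trans ?_
  rw [not_lt]
  exact ⟨fun h => le_antisymm (valuation_aeval_le hAW (W.valuation_binary_le t) hf) h,
    fun h => h.ge⟩

end ValuationSubring

end CenterOnProjectiveLine

/-! ### The A-morphism of centers. -/

namespace ZariskiRiemann

open MvPolynomial

variable {F : Type u} [Field F] {D : Subring F} {Z : Set (ZariskiRiemann D)}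

lemma holomorphyRing_le (V : Z) : holomorphyRing Z ≤ V.1.ring.toSubring :=
  fun _ ha => mem_holomorphyRing.1 ha V.1 V.2

lemma isOpen_setOf_valuation_aeval_eq (t : F) {d : ℕ}
    {f : MvPolynomial (Fin 2) (holomorphyRing Z)} (hf : f.IsHomogeneous d) :
    IsOpen {V : Z | V.1.ring.valuation (aeval ![1, t] f) =
      max 1 (V.1.ring.valuation t) ^ d} := by
  by_cases h0 : aeval ![1, t] f = (0 : F)
  · convert isOpen_empty using 1
    ext V
    simp only [h0, map_zero, Set.mem_ofPred_eq, Set.mem_empty_iff_false, iff_false]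
    exact (pow_pos (lt_of_lt_of_le zero_lt_one (le_max_left _ _)) _).ne
  · have hopen (x : F) : IsOpen {V : Z | x ∈ V.1.ring} :=
      (isOpen_setOf_mem x).preimage continuous_subtype_val
    -- The lower bound says that f(1, t) has value at least those of 1 and t^d, so both quotients
    -- lie in V.
    convert (hopen (1 / aeval ![1, t] f)).inter (hopen (t ^ d / aeval ![1, t] f)) using 1
    ext V
    have hpos := zero_lt_iff.2 (V.1.ring.valuation.ne_zero_iff.2 h0)
    simp only [Set.mem_ofPred_eq, Set.mem_inter_iff, ← ValuationSubring.valuation_le_one_iff,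
      map_div₀, map_one, map_pow, div_le_one₀ hpos]
    have hmax : max 1 (V.1.ring.valuation t) ^ d = max 1 (V.1.ring.valuation t ^ d) := by
      rw [(pow_left_mono d).map_max, one_pow]
    rw [← max_le_iff, ← hmax]
    exact ⟨fun h => h.ge, fun h => le_antisymm (ValuationSubring.valuation_aeval_le
      (holomorphyRing_le V) (V.1.ring.valuation_binary_le t) hf) h⟩

/-- The map from `Z` to the projective line over the holomorphy ring that sends a valuation ring
to its center at the point `(1 : t)`. -/
def centerMap (Z : Set (ZariskiRiemann D)) (t : F) : TopCat.of Z ⟶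
    TopCat.of (ProjectiveSpectrum (homogeneousSubmodule (Fin 2) (holomorphyRing Z))) :=
  TopCat.ofHom
    { toFun := fun V => ValuationSubring.center (holomorphyRing_le V) t
      continuous_toFun := by
        refine (ProjectiveSpectrum.isTopologicalBasis_basic_opens _).continuous_iff.2 ?_
        rintro _ ⟨f, rfl⟩
        -- The polynomial f need not be homogeneous; it lies outside a homogeneous prime exactly
        -- when one of its components does.
        have : (fun V : Z => ValuationSubring.center (holomorphyRing_le V) t) ⁻¹'
            (ProjectiveSpectrum.basicOpen (homogeneousSubmodule (Fin 2) (holomorphyRing Z)) f).1 =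
            ⋃ d, {V : Z | V.1.ring.valuation (aeval ![1, t] (homogeneousComponent d f)) =
              max 1 (V.1.ring.valuation t) ^ d} := by
          ext V
          simp only [Set.mem_iUnion, Set.mem_ofPred_eq]
          simp_rw [← ValuationSubring.mem_primeCompl_center_iff (holomorphyRing_le V) t
            (homogeneousComponent_isHomogeneous _ f)]
          exact (not_congr (mem_iff_homogeneousComponent_mem
            (ValuationSubring.center (holomorphyRing_le V)
              t).asHomogeneousIdeal.isHomogeneous f)).trans not_forall
        exact (congrArg IsOpen this).mpr (isOpen_iUnion fun d =>
          isOpen_setOf_valuation_aeval_eq t (homogeneousComponent_isHomogeneous d f)) }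

lemma isCompatible_centerMap (Z : Set (ZariskiRiemann D)) (t : F) :
    IsCompatible (aeval (R := holomorphyRing Z) ![1, t]).toRingHom (centerMap Z t) where
  ne_zero V i s hs hsV := by
    have h := (ValuationSubring.mem_primeCompl_center_iff (holomorphyRing_le V) t hs).1 hsV
    refine V.1.ring.valuation.ne_zero_iff.1 (h.trans_ne ?_)
    exact (pow_pos (lt_of_lt_of_le zero_lt_one (le_max_left _ _)) _).ne'
  div_mem V i r hr s hs hsV := by
    have h := (ValuationSubring.mem_primeCompl_center_iff (holomorphyRing_le V) t hs).1 hsV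
    rw [← ValuationSubring.valuation_le_one_iff, map_div₀]
    change _ / V.1.ring.valuation (aeval ![1, t] s) ≤ 1
    rw [h, div_le_one₀ (pow_pos (lt_of_lt_of_le zero_lt_one (le_max_left _ _)) _)]
    exact ValuationSubring.valuation_aeval_le (holomorphyRing_le V)
      (V.1.ring.valuation_binary_le t) hr
  isLocal V i r hr s hs hsV hr0 hrs := by
    have h := (ValuationSubring.mem_primeCompl_center_iff (holomorphyRing_le V) t hs).1 hsV
    refine (ValuationSubring.mem_primeCompl_center_iff (holomorphyRing_le V) t hr).2 ?_
    refine le_antisymm (ValuationSubring.valuation_aeval_le (holomorphyRing_le V)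
      (V.1.ring.valuation_binary_le t) hr) ?_
    rw [← ValuationSubring.valuation_le_one_iff, map_div₀,
      div_le_one₀ (zero_lt_iff.2 (V.1.ring.valuation.ne_zero_iff.2 hr0))] at hrs
    exact h.ge.trans hrs

lemma centerMap_comp_toSpec (hF : generic ∈ Z) (t : F) :
    (isCompatible_centerMap Z t).hom hF ≫
      (ProjectiveLine.toSpec (holomorphyRing Z)).toLRSHom = structureMorphism Z hF := by
  rw [comp_toSpec_eq_structureMorphism_iff]
  intro a
  apply Subtype.ext
  funext V
  change aeval ![1, t] (algebraMap (holomorphyRing Z) _ a) / aeval ![1, t] 1 = (a : F)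
  rw [AlgHom.commutes, map_one, div_one]
  rfl

lemma hasNonvanishingForm_of_forall_hom (hF : generic ∈ Z)
    (h : ∀ φ : locallyRingedSpace Z hF ⟶ (ProjectiveLine (holomorphyRing Z)).toLocallyRingedSpace,
      φ ≫ (ProjectiveLine.toSpec (holomorphyRing Z)).toLRSHom = structureMorphism Z hF →
        ∃ (d : ℕ) (f : MvPolynomial (Fin 2) (holomorphyRing Z)), 0 < d ∧ f.IsHomogeneous d ∧
          Set.range φ.base ⊆ (ProjectiveLine.basicOpen f : Set _)) (t : F) :
    HasNonvanishingForm (holomorphyRing Z) (fun V : Z => V.1.ring) t := by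
  obtain ⟨d, f, hd, hf, hrange⟩ :=
    h ((isCompatible_centerMap Z t).hom hF) (centerMap_comp_toSpec hF t)
  exact ⟨d, f, hd, hf, fun V => (ValuationSubring.mem_primeCompl_center_iff
    (holomorphyRing_le V) t hf).1 (hrange ⟨V, rfl⟩)⟩

end ZariskiRiemann

/-! ### Standard charts of projective space. -/

section Dehomogenization

open MvPolynomial

variable {σ A : Type*} [CommRing A] (S : Submonoid (MvPolynomial σ A))

/-- The quotient `X j / X l` in a homogeneous localization of a polynomial ring. -/
def homogeneousRatio {l : σ} (hl : X l ∈ S) (j : σ) :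
    HomogeneousLocalization (homogeneousSubmodule σ A) S :=
  .mk ⟨1, ⟨X j, isHomogeneous_X A j⟩, ⟨X l, isHomogeneous_X A l⟩, hl⟩

/-- This is f / X_l^d = f(X / X_l), obtained in the full localization by pulling out the factor 1 /
X_l by homogeneity. -/
lemma mk_X_pow_eq_eval₂ {l : σ} (hl : X l ∈ S) {d : ℕ} {f : MvPolynomial σ A}
    (hf : f.IsHomogeneous d) :
    (.mk ⟨d, ⟨f, hf⟩, ⟨X l ^ d, isHomogeneous_X_pow l d⟩, pow_mem hl d⟩ :
      HomogeneousLocalization (homogeneousSubmodule σ A) S) =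
    eval₂ ((HomogeneousLocalization.fromZeroRingHom (homogeneousSubmodule σ A) S).comp
      (algebraMap A (homogeneousSubmodule σ A 0))) (homogeneousRatio S hl) f := by
  apply HomogeneousLocalization.val_injective
  rw [HomogeneousLocalization.val_mk, ← HomogeneousLocalization.algebraMap_apply, eval₂_comp_left]
  have h1 : (algebraMap (HomogeneousLocalization (homogeneousSubmodule σ A) S) (Localization S)) ∘
      homogeneousRatio S hl = fun j => Localization.mk 1 ⟨X l, hl⟩ *
        algebraMap (MvPolynomial σ A) (Localization S) (X j) := by
    funext j
    rw [← Localization.mk_one_eq_algebraMap, Localization.mk_mul, one_mul, mul_one]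
    exact HomogeneousLocalization.val_mk _
  have h2 : (algebraMap (HomogeneousLocalization (homogeneousSubmodule σ A) S)
      (Localization S)).comp ((HomogeneousLocalization.fromZeroRingHom
        (homogeneousSubmodule σ A) S).comp (algebraMap A (homogeneousSubmodule σ A 0))) =
      (algebraMap (MvPolynomial σ A) (Localization S)).comp C := by
    ext a
    rw [RingHom.comp_apply, RingHom.comp_apply, RingHom.comp_apply,
      ← Localization.mk_one_eq_algebraMap]
    exact HomogeneousLocalization.val_mk _
  rw [h1, h2, eval₂_const_mul_of_isHomogeneous _ _ _ hf]
  have h3 : eval₂ ((algebraMap (MvPolynomial σ A) (Localization S)).comp C)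
      (fun j => algebraMap (MvPolynomial σ A) (Localization S) (X j)) f = algebraMap _ _ f :=
    (eval₂_comp_left _ C X f).symm.trans (congrArg _ (eval₂_eta f))
  rw [h3, Localization.mk_pow, one_pow, ← Localization.mk_one_eq_algebraMap, Localization.mk_mul,
    one_mul, mul_one]
  rfl

lemma homogeneousRatio_self {l : σ} (hl : X l ∈ S) : homogeneousRatio S hl l = 1 := by
  apply HomogeneousLocalization.val_injective
  rw [HomogeneousLocalization.val_one]
  exact (HomogeneousLocalization.val_mk _).trans (Localization.mk_self ⟨_, hl⟩)

lemma homogeneousRatio_mul {k l : σ} (hk : X k ∈ S) (hl : X l ∈ S) (j : σ) :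
    homogeneousRatio S hl k * homogeneousRatio S hk j = homogeneousRatio S hl j := by
  apply HomogeneousLocalization.val_injective
  rw [HomogeneousLocalization.val_mul, homogeneousRatio, homogeneousRatio, homogeneousRatio,
    HomogeneousLocalization.val_mk, HomogeneousLocalization.val_mk,
    HomogeneousLocalization.val_mk, Localization.mk_mul, Localization.mk_eq_mk_iff,
    Localization.r_iff_exists]
  refine ⟨1, ?_⟩
  push_cast
  ring

lemma exists_X_mem_primeCompl (x : ProjectiveSpectrum (homogeneousSubmodule σ A)) :
    ∃ j, X j ∈ x.asHomogeneousIdeal.toIdeal.primeCompl := by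
  by_contra! h
  refine x.not_irrelevant_le fun f hf => ?_
  have hle : Ideal.span (X '' Set.univ) ≤ x.asHomogeneousIdeal.toIdeal := by
    refine Ideal.span_le.2 ?_
    rintro _ ⟨j, -, rfl⟩
    exact not_not.1 (h j)
  refine hle (mem_ideal_span_X_image.2 fun m hm => ?_)
  have hm0 : m ≠ 0 := by
    rintro rfl
    have h0 : (homogeneousComponent 0 f) = 0 := by
      rw [← (decomposition.decompose'_apply f 0)]
      exact (HomogeneousIdeal.mem_irrelevant_iff _ _).1 hf
    rw [homogeneousComponent_zero, C_eq_zero] at h0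
    exact mem_support_iff.1 hm h0
  obtain ⟨j, hj⟩ := Finsupp.ne_iff.1 hm0
  exact ⟨j, trivial, hj⟩

end Dehomogenization

/-! ### Arbitrary A-morphisms to the projective line. -/

lemma HasNonvanishingForm.exists_of_forall {F ι : Type*} [Field F] {A : Subring F}
    {V : ι → ValuationSubring F} (h : ∀ t, HasNonvanishingForm A V t) (x : Fin 2 → F) :
    ∃ (d : ℕ) (f : MvPolynomial (Fin 2) A), 0 < d ∧ f.IsHomogeneous d ∧
      ∀ i, (V i).valuation (MvPolynomial.aeval x f) =
        max ((V i).valuation (x 0)) ((V i).valuation (x 1)) ^ d := by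
  by_cases hx : x 0 = 0
  -- At x 0 = 0 the ratio x 1 / x 0 is not available, but the second variable already fits.
  · exact ⟨1, MvPolynomial.X 1, one_pos, MvPolynomial.isHomogeneous_X A 1, fun i => by simp [hx]⟩
  · obtain ⟨d, f, hd, hf, h⟩ := h (x 1 / x 0)
    refine ⟨d, f, hd, hf, fun i => ?_⟩
    have hx' : (fun j => x 0 * (![1, x 1 / x 0] : Fin 2 → F) j) = x := by
      funext j
      fin_cases j
      · simp
      · simp [mul_div_cancel₀ _ hx]
    conv_lhs => rw [← hx', MvPolynomial.aeval_def,
      MvPolynomial.eval₂_const_mul_of_isHomogeneous _ _ _ hf, ← MvPolynomial.aeval_def, map_mul,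
      map_pow, h i, ← mul_pow, mul_max, mul_one, ← map_mul, mul_div_cancel₀ _ hx]

namespace ZariskiRiemann

open MvPolynomial

variable {F : Type u} [Field F] {D : Subring F} {Z : Set (ZariskiRiemann D)} {hF : generic ∈ Z}
  (φ : locallyRingedSpace Z hF ⟶
    (Proj (homogeneousSubmodule (Fin 2) (holomorphyRing Z))).toLocallyRingedSpace)

lemma genericPullback_comp_algebraMap
    (hφ : φ ≫ (ProjectiveLine.toSpec (holomorphyRing Z)).toLRSHom = structureMorphism Z hF) :
    (genericPullback φ).comp ((HomogeneousLocalization.fromZeroRingHom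
      (homogeneousSubmodule (Fin 2) (holomorphyRing Z)) _).comp
        (algebraMap (holomorphyRing Z) (homogeneousSubmodule (Fin 2) (holomorphyRing Z) 0))) =
      algebraMap (holomorphyRing Z) F := by
  ext a
  have h1 := (comp_toSpec_eq_structureMorphism_iff hF φ).1 hφ a
  refine (localPullback_apply φ ⟨generic, hF⟩ ⊤ trivial
    ((ProjectiveLine.constGlobal (holomorphyRing Z)).hom a)).trans ?_
  exact congrFun (congrArg Subtype.val h1) _

lemma exists_range_subset_basicOpen
    (h : ∀ t, HasNonvanishingForm (holomorphyRing Z) (fun V : Z => V.1.ring) t)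
    (hφ : φ ≫ (ProjectiveLine.toSpec (holomorphyRing Z)).toLRSHom = structureMorphism Z hF) :
    ∃ (d : ℕ) (f : MvPolynomial (Fin 2) (holomorphyRing Z)), 0 < d ∧ f.IsHomogeneous d ∧
      ∀ V : Z, f ∈ (imagePoint φ V).asHomogeneousIdeal.toIdeal.primeCompl := by
  let S := (imagePoint φ ⟨generic, hF⟩).asHomogeneousIdeal.toIdeal.primeCompl
  let y {l : Fin 2} (hl : X l ∈ S) (j : Fin 2) : F :=
    genericPullback φ (homogeneousRatio S hl j)
  have hy {l : Fin 2} (hl : X l ∈ S) {d : ℕ} {f : MvPolynomial (Fin 2) (holomorphyRing Z)}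
      (hf : f.IsHomogeneous d) : genericPullback φ
        (.mk ⟨d, ⟨f, hf⟩, ⟨X l ^ d, isHomogeneous_X_pow l d⟩, pow_mem hl d⟩) = aeval (y hl) f := by
    rw [mk_X_pow_eq_eval₂ S hl hf, eval₂_comp_left, genericPullback_comp_algebraMap φ hφ]
    rfl
  obtain ⟨k, hk⟩ := exists_X_mem_primeCompl (imagePoint φ ⟨generic, hF⟩)
  obtain ⟨d, f, hd, hf, hval⟩ := HasNonvanishingForm.exists_of_forall h (y hk)
  refine ⟨d, f, hd, hf, fun V => ?_⟩
  -- The chart suited to V may differ from the chart k in which f was chosen. Its coordinates are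
  -- those in chart k times a common factor, lie in V, and include a 1, so their maximal value is 1
  -- and f takes a unit value there.
  obtain ⟨l, hlV⟩ := exists_X_mem_primeCompl (imagePoint φ V)
  have hl : X l ∈ S := generic_mem_preimage φ (U := ProjectiveSpectrum.basicOpen _ (X l)) hlV
  refine mem_primeCompl_of_valuation_genericPullback φ ⟨f, hf⟩
    ⟨X l ^ d, isHomogeneous_X_pow l d⟩ (pow_mem hlV d) ?_
  have hyl : y hl = fun j => y hl k * y hk j := by
    funext j
    rw [← map_mul, homogeneousRatio_mul]
  have hmul (j : Fin 2) : V.1.ring.valuation (y hl k) * V.1.ring.valuation (y hk j) =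
      V.1.ring.valuation (y hl j) :=
    (map_mul _ _ _).symm.trans (congrArg _ (congrFun hyl j).symm)
  have hle (j : Fin 2) : V.1.ring.valuation (y hl j) ≤ 1 :=
    valuation_genericPullback_le_one φ ⟨X j, isHomogeneous_X _ j⟩ ⟨X l, isHomogeneous_X _ l⟩ hlV
  have hself : V.1.ring.valuation (y hl l) = 1 := by
    rw [show y hl l = 1 from (congrArg _ (homogeneousRatio_self S hl)).trans (map_one _), map_one]
  have hmax : max (V.1.ring.valuation (y hl 0)) (V.1.ring.valuation (y hl 1)) = 1 := by
    refine le_antisymm (max_le (hle 0) (hle 1)) (hself.symm.trans_le ?_)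
    fin_cases l
    · exact le_max_left _ _
    · exact le_max_right _ _
  refine (congrArg V.1.ring.valuation (hy hl hf)).trans ?_
  rw [hyl, aeval_def, eval₂_const_mul_of_isHomogeneous _ _ _ hf, ← aeval_def, map_mul, map_pow,
    hval V, ← mul_pow, mul_max, hmul 0, hmul 1, hmax, one_pow]

end ZariskiRiemann

end

theorem theorem3p5 {F : Type u} [Field F] (D : Subring F) (Z : Set (ZariskiRiemann D))
    (hF : ZariskiRiemann.generic ∈ Z) :
    (IsPruferDomain (ZariskiRiemann.holomorphyRing Z) ∧
        IsMulTorsion (CommRing.Pic (ZariskiRiemann.holomorphyRing Z)) ∧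
        IsFractionRing (ZariskiRiemann.holomorphyRing Z) F) ↔
      ∀ φ : ZariskiRiemann.locallyRingedSpace Z hF ⟶
          (ProjectiveLine (ZariskiRiemann.holomorphyRing Z)).toLocallyRingedSpace,
        φ ≫ (ProjectiveLine.toSpec (ZariskiRiemann.holomorphyRing Z)).toLRSHom =
            ZariskiRiemann.structureMorphism Z hF →
          ∃ (d : ℕ) (f : MvPolynomial (Fin 2) (ZariskiRiemann.holomorphyRing Z)),
            0 < d ∧ f.IsHomogeneous d ∧
              Set.range φ.base ⊆ (ProjectiveLine.basicOpen f : Set _) := by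
  have hA (a : F) : a ∈ ZariskiRiemann.holomorphyRing Z ↔ ∀ V : Z, a ∈ V.1.ring :=
    ZariskiRiemann.mem_holomorphyRing.trans
      ⟨fun h V => h V.1 V.2, fun h V hV => h ⟨V, hV⟩⟩
  have : Nonempty Z := ⟨⟨_, hF⟩⟩
  constructor
  · rintro ⟨hP, hT, _⟩ φ hφ
    obtain ⟨d, f, hd, hf, h⟩ := ZariskiRiemann.exists_range_subset_basicOpen φ
      (hasNonvanishingForm_of_isPruferDomain hA hP hT) hφ
    exact ⟨d, f, hd, hf, by rintro _ ⟨V, rfl⟩; exact h V⟩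
  · intro h
    have hform := ZariskiRiemann.hasNonvanishingForm_of_forall_hom hF h
    have hmon := fun t => (hform t).exists_monomials_mem hA
    have hfrac := isFractionRing_of_monomials hmon
    exact ⟨isPruferDomain_of_monomials hmon, isMulTorsion_pic_of_hasNonvanishingForm hA hform,
      hfrac⟩
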